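/- Fix $T>0$, $\chi>0$, $\alpha\in(0,2)$ and $c^+,c^-\ge 0$ with $c^++c^->0$. Let $$\mathcal L f(x)=\int_{\mathbb R}\frac{c(y)}{|y|^{1+\alpha}}\big(f(x+y)-f(x)-\theta^\alpha(y)f'(x)\big)\,dy,$$ where $c(y)=c^+$ for $y>0$, $c(0)=0$, $c(y)=c^-$ for $y<0$, and $\theta^\alpha(y)=0$ if $\alpha<1$, $\theta^\alpha(y)=y\mathbf 1(|y|\le 1)$ if $\alpha=1$, $\theta^\alpha(y)=y$ if $\alpha>1$. Let $\mathcal L^*$ be the adjoint of $\mathcal L$ in $L^2(\mathbb R)$ (the same operator with $c^+$ and $c^-$ exchanged), and $\mathcal S=\frac12(\mathcal L+\mathcal L^*)$. Let $\mathbb S(\mathbb R)$ be the space of real Schwartz functions and $\mathbb S'(\mathbb R)$ its dual, the space of tempered distributions, and let $\psi_\varepsilon(x)=e^{-(\varepsilon x)^2}$. Let $\{\mathcal Y_t;t\in[0,T]\}$ be a (measurable) $\mathbb S'(\mathbb R)$-valued process on a probability space. It is called a stationary solution of the infinite-dimensional Ornstein--Uhlenbeck equation $$d\mathcal Y_t=\mathcal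 L^*\mathcal Y_t\,dt+\sqrt{2\chi(-\mathcal S)}\,d\mathcal W_t$$ if (i) for every $t\in[0,T]$, $\mathcal Y_t$ is a white noise of variance $\chi$: for every $f\in\mathbb S(\mathbb R)$ the variable $\mathcal Y_t(f)$ is Gaussian with mean $0$ and variance $\chi\int f(x)^2dx$; and (ii) for every continuously differentiable $f:[0,T]\to\mathbb S(\mathbb R)$ the process $$\mathcal Y_t(f_t)-\mathcal Y_0(f_0)-\int_0^t\mathcal Y_s(\partial_sf_s)\,ds-\int_0^t\mathcal Y_s(\mathcal Lf_s)\,ds,\qquad t\in[0,T],$$ is (up to modification) a continuous martingale, with respect to the completed natural filtration of $\mathcal Y$, of quadratic variation $2\chi\int_0^t\int_{\mathbb R} f_s(x)\,(-\mathcal Sf_s)(x)\,dx\,ds$. Here $\int_0^t\mathcal Y_s(\mathcal Lf_s)\,ds$ denotes the $L^2$-limit, as $\varepsilon\to0$, of $\int_0^t\mathcal Y_s(\psi_\varepsilon\mathcal Lf_s)\,ds$. Then any two stationary solutions of this equation (with the same $T,\chi,\alpha,c^+,c^-$), possibly defined on different probability spaces, have the same law as $\mathbb S'(\mathbb R)$-valued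 processes indexed by $[0,T]$. -/

import Mathlib

open MeasureTheory ProbabilityTheory Filter Topology
open scoped SchwartzMap ENNReal NNReal

namespace StableOU

/-! ### The stable generator -/

/-- The coefficient `c(y)`: equal to `cp` for `y > 0`, to `0` at `y = 0`, to `cm` for `y < 0`. -/
noncomputable def jumpCoeff (cp cm y : ℝ) : ℝ :=
  if 0 < y then cp else if y < 0 then cm else 0

/-- The centering `θ^α(y)`: `0` if `α < 1`, `y 1(|y| ≤ 1)` if `α = 1`, `y` if `α > 1`. -/
noncomputable def centering (α y : ℝ) : ℝ :=
  if α < 1 then 0 else if α = 1 then (if |y| ≤ 1 then y else 0) else y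

/-- The integrand in the definition of the generator. -/
noncomputable def levyIntegrand (cp cm α : ℝ) (f : ℝ → ℝ) (x y : ℝ) : ℝ :=
  jumpCoeff cp cm y / |y| ^ (1 + α) * (f (x + y) - f x - centering α y * deriv f x)

/-- The generator `L = L(cp, cm; α)` of the `α`-stable Lévy process,
`L f(x) = ∫ c(y) |y|^{-1-α} (f(x+y) - f(x) - θ^α(y) f'(x)) dy`. -/
noncomputable def levyOp (cp cm α : ℝ) (f : ℝ → ℝ) (x : ℝ) : ℝ :=
  ∫ y, levyIntegrand cp cm α f x y

/-- The adjoint of `L(cp, cm; α)` in `L²(ℝ)`, which is `L(cm, cp; α)`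
(see `integral_levyOp_mul` for the duality). -/
noncomputable def levyOpAdj (cp cm α : ℝ) (f : ℝ → ℝ) (x : ℝ) : ℝ :=
  levyOp cm cp α f x

/-- The symmetric part `S = (L + L^*) / 2`. -/
noncomputable def levySym (cp cm α : ℝ) (f : ℝ → ℝ) (x : ℝ) : ℝ :=
  (levyOp cp cm α f x + levyOpAdj cp cm α f x) / 2

/-! ### Facts on the generator, which show that the definitions below are meaningful -/

/-- An integrable function of the jump size that dominates the integrand of `L f`. -/
noncomputable def jumpBound (α y : ℝ) : ℝ :=
  if |y| ≤ 1 then |y| ^ ((if α < 1 then 1 else 2) - 1 - α)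
  else |y| ^ ((if α ≤ 1 then 0 else 1) - 1 - α : ℝ)

theorem jumpBound_nonneg (α y : ℝ) : 0 ≤ jumpBound α y := by
  unfold jumpBound
  split <;> positivity

theorem integrable_jumpBound {α : ℝ} (h0 : 0 < α) (h2 : α < 2) :
    Integrable (jumpBound α) := by
  have key : IntegrableOn (fun y : ℝ => jumpBound α y) (Set.Ioi 0) := by
    rw [← Set.Ioc_union_Ioi_eq_Ioi (zero_le_one : (0 : ℝ) ≤ 1)]
    refine IntegrableOn.union ?_ ?_
    · have h : IntegrableOn (fun y : ℝ => y ^ (((if α < 1 then 1 else 2) - 1 - α : ℝ)))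
          (Set.Ioc 0 1) := by
        rw [← intervalIntegrable_iff_integrableOn_Ioc_of_le zero_le_one]
        apply intervalIntegral.intervalIntegrable_rpow'
        split_ifs <;> linarith
      refine h.congr_fun (fun y hy => ?_) measurableSet_Ioc
      simp only [Set.mem_Ioc] at hy
      simp [jumpBound, abs_of_pos hy.1, hy.2]
    · have h : IntegrableOn (fun y : ℝ => y ^ (((if α ≤ 1 then 0 else 1) - 1 - α : ℝ)))
          (Set.Ioi 1) := by
        apply integrableOn_Ioi_rpow_of_lt _ zero_lt_one
        split_ifs <;> linarith
      refine h.congr_fun (fun y hy => ?_) measurableSet_Ioi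
      simp only [Set.mem_Ioi] at hy
      have : (0 : ℝ) < y := by linarith
      simp [jumpBound, abs_of_pos this, not_le.2 hy]
  have key2 : IntegrableOn (fun y : ℝ => jumpBound α y) (Set.Iic 0) := by
    have h := key.comp_neg
    simp only [Set.neg_Ioi, neg_zero] at h
    rw [integrableOn_Iic_iff_integrableOn_Iio]
    refine h.congr_fun (fun y _ => ?_) measurableSet_Iio
    simp [jumpBound]
  rw [← integrableOn_univ, ← Set.Iic_union_Ioi (a := (0 : ℝ))]
  exact key2.union key

theorem measurable_jumpCoeff (cp cm : ℝ) : Measurable (jumpCoeff cp cm) := by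
  unfold jumpCoeff
  exact Measurable.ite measurableSet_Ioi measurable_const
    (Measurable.ite measurableSet_Iio measurable_const measurable_const)

theorem measurable_centering (α : ℝ) : Measurable (centering α) := by
  unfold centering
  split_ifs
  · exact measurable_const
  · exact Measurable.ite (measurableSet_le (by fun_prop) (by fun_prop)) measurable_id
      measurable_const
  · exact measurable_id

theorem measurable_levyIntegrand (cp cm α : ℝ) (f : 𝓢(ℝ, ℝ)) :
    Measurable (Function.uncurry (levyIntegrand cp cm α f)) := by
  have h1 : Measurable (fun p : ℝ × ℝ => jumpCoeff cp cm p.2) :=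
    (measurable_jumpCoeff cp cm).comp measurable_snd
  have h2 : Measurable (fun p : ℝ × ℝ => centering α p.2) :=
    (measurable_centering α).comp measurable_snd
  have h3 : Measurable (fun x : ℝ => f x) := f.continuous.measurable
  have h4 : Measurable (fun x : ℝ => deriv f x) := measurable_deriv _
  unfold levyIntegrand Function.uncurry
  exact (h1.div ((measurable_snd.abs).pow_const _)).mul
    (((h3.comp (measurable_fst.add measurable_snd)).sub (h3.comp measurable_fst)).sub
      (h2.mul (h4.comp measurable_fst)))

theorem schwartz_bounded (f : 𝓢(ℝ, ℝ)) : ∃ C, 0 ≤ C ∧ ∀ x, |f x| ≤ C := by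
  obtain ⟨C, hC0, hC⟩ := f.decay 0 0
  exact ⟨C, hC0.le, fun x => by simpa using hC x⟩

theorem abs_sub_le_of_deriv (g : ℝ → ℝ) (hg : Differentiable ℝ g) {C : ℝ}
    (hC : ∀ x, |deriv g x| ≤ C) (x y : ℝ) : |g (x + y) - g x| ≤ C * |y| := by
  have := Convex.norm_image_sub_le_of_norm_deriv_le (f := g) (s := Set.univ) (x := x) (y := x + y)
    (fun z _ => hg z) (fun z _ => hC z) convex_univ trivial trivial
  simpa using this

theorem taylor_bound (f : 𝓢(ℝ, ℝ)) : ∃ C, 0 ≤ C ∧ ∀ x y,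
    |f (x + y) - f x| ≤ C ∧ |f (x + y) - f x| ≤ C * |y| ∧ |deriv f x| ≤ C ∧
    |f (x + y) - f x - y * deriv f x| ≤ C * |y| ^ 2 := by
  obtain ⟨C0, h0, H0⟩ := schwartz_bounded f
  obtain ⟨C1, h1, H1⟩ := schwartz_bounded (SchwartzMap.derivCLM ℝ ℝ f)
  obtain ⟨C2, h2, H2⟩ := schwartz_bounded
    (SchwartzMap.derivCLM ℝ ℝ (SchwartzMap.derivCLM ℝ ℝ f))
  have e1 : (⇑(SchwartzMap.derivCLM ℝ ℝ f) : ℝ → ℝ) = deriv f := by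
    ext x; exact SchwartzMap.derivCLM_apply ℝ f x
  have e2 : (⇑(SchwartzMap.derivCLM ℝ ℝ (SchwartzMap.derivCLM ℝ ℝ f)) : ℝ → ℝ)
      = deriv (deriv f) := by
    ext x; rw [SchwartzMap.derivCLM_apply, e1]
  rw [e1] at H1
  rw [e2] at H2
  have d0 : Differentiable ℝ f := f.differentiable
  have d1 : Differentiable ℝ (deriv f) := by
    rw [← e1]; exact (SchwartzMap.derivCLM ℝ ℝ f).differentiable
  refine ⟨2 * C0 + C1 + C2, by positivity, fun x y => ⟨?_, ?_, ?_, ?_⟩⟩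
  · have := H0 x
    have := H0 (x + y)
    have := abs_sub (f (x + y)) (f x)
    linarith
  · have := abs_sub_le_of_deriv f d0 H1 x y
    nlinarith [abs_nonneg y]
  · have := H1 x
    linarith
  · have hd : ∀ z, HasDerivAt (fun z => f z - (z - x) * deriv f x) (deriv f z - deriv f x) z := by
      intro z
      have := (d0 z).hasDerivAt.sub (((hasDerivAt_id z).sub_const x).mul_const (deriv f x))
      rw [one_mul] at this
      exact this
    have hb : ∀ z ∈ Set.uIcc x (x + y), ‖deriv f z - deriv f x‖ ≤ C2 * |y| := by
      intro z hz
      have h := abs_sub_le_of_deriv (deriv f) d1 H2 x (z - x)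
      have h' : |z - x| ≤ |y| := by
        have := Set.abs_sub_left_of_mem_uIcc hz
        simpa using this
      rw [show x + (z - x) = z by ring] at h
      rw [Real.norm_eq_abs]
      nlinarith
    have := Convex.norm_image_sub_le_of_norm_hasDerivWithin_le
      (f := fun z => f z - (z - x) * deriv f x) (s := Set.uIcc x (x + y))
      (fun z _ => (hd z).hasDerivWithinAt) hb (convex_uIcc _ _)
      Set.left_mem_uIcc Set.right_mem_uIcc
    simp only [add_sub_cancel_left, Real.norm_eq_abs, sub_self, zero_mul, sub_zero] at this
    rw [show f (x + y) - f x - y * deriv f x = f (x + y) - y * deriv f x - f x by ring]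
    nlinarith [mul_nonneg (abs_nonneg y) (abs_nonneg y)]

theorem levyIntegrand_bound (cp cm α : ℝ) (f : 𝓢(ℝ, ℝ)) :
    ∃ C, 0 ≤ C ∧ ∀ x y, |levyIntegrand cp cm α f x y| ≤ C * jumpBound α y := by
  obtain ⟨C, hC, H⟩ := taylor_bound f
  refine ⟨(|cp| + |cm|) * (2 * C), by positivity, fun x y => ?_⟩
  obtain ⟨Ha, Hb, Hc, Hd⟩ := H x y
  have hj : |jumpCoeff cp cm y| ≤ |cp| + |cm| := by
    unfold jumpCoeff
    split_ifs
    · linarith [abs_nonneg cm]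
    · linarith [abs_nonneg cp]
    · simp; positivity
  rcases eq_or_ne y 0 with rfl | hy
  · simp only [levyIntegrand, jumpCoeff, lt_self_iff_false, if_false, zero_div, zero_mul, abs_zero]
    exact mul_nonneg (by positivity) (jumpBound_nonneg _ _)
  have hy' : 0 < |y| := abs_pos.2 hy
  have hp : 0 < |y| ^ (1 + α) := Real.rpow_pos_of_pos hy' _
  suffices hs : |f (x + y) - f x - centering α y * deriv f x|
      ≤ (2 * C) * (jumpBound α y * |y| ^ (1 + α)) by
    unfold levyIntegrand
    rw [abs_mul, abs_div, abs_of_pos hp, div_mul_eq_mul_div, div_le_iff₀ hp]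
    calc _ ≤ (|cp| + |cm|) * ((2 * C) * (jumpBound α y * |y| ^ (1 + α))) := by gcongr
      _ = _ := by ring
  have hpow : ∀ a : ℝ, |y| ^ (a - 1 - α) * |y| ^ (1 + α) = |y| ^ a := by
    intro a
    rw [← Real.rpow_add hy']
    congr 1
    ring
  have hsplit : |y| ^ 2 = |y| ^ (2 : ℝ) := by norm_cast
  have hC1 : 0 ≤ C * |y| := by positivity
  have hC2 : 0 ≤ C * |y| ^ 2 := by positivity
  unfold jumpBound centering
  by_cases h1 : |y| ≤ 1
  · rw [if_pos h1, if_pos h1, hpow]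
    rcases lt_trichotomy α 1 with h | h | h
    · simp only [h, if_true, Real.rpow_one, zero_mul, sub_zero]
      linarith
    · simp only [h, lt_irrefl, if_true, if_false, ← hsplit]
      linarith
    · simp only [not_lt.2 h.le, h.ne', if_false, ← hsplit]
      linarith
  · rw [if_neg h1, if_neg h1, hpow]
    rcases lt_trichotomy α 1 with h | h | h
    · simp only [h, h.le, if_true, Real.rpow_zero, zero_mul, sub_zero]
      linarith
    · simp only [h, lt_irrefl, le_refl, if_true, if_false, Real.rpow_zero, zero_mul, sub_zero]
      linarith
    · simp only [not_lt.2 h.le, not_le.2 h, h.ne', if_false, Real.rpow_one]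
      have h3 := abs_sub (f (x + y) - f x) (y * deriv f x)
      rw [abs_mul y] at h3
      nlinarith

theorem integrable_levyIntegrand (cp cm : ℝ) {α : ℝ} (h0 : 0 < α) (h2 : α < 2) (f : 𝓢(ℝ, ℝ))
    (x : ℝ) : Integrable (levyIntegrand cp cm α f x) := by
  obtain ⟨C, -, hC⟩ := levyIntegrand_bound cp cm α f
  refine ((integrable_jumpBound h0 h2).const_mul C).mono' ?_ (.of_forall fun y => hC x y)
  exact ((measurable_levyIntegrand cp cm α f).of_uncurry_left (x := x)).aestronglyMeasurable

/-- `L f` is bounded for a Schwartz function `f`. -/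
theorem levyOp_bounded (cp cm : ℝ) {α : ℝ} (h0 : 0 < α) (h2 : α < 2) (f : 𝓢(ℝ, ℝ)) :
    ∃ C, ∀ x, |levyOp cp cm α f x| ≤ C := by
  obtain ⟨C, -, hC⟩ := levyIntegrand_bound cp cm α f
  refine ⟨∫ y, C * jumpBound α y, fun x => ?_⟩
  rw [← Real.norm_eq_abs, levyOp]
  exact norm_integral_le_of_norm_le ((integrable_jumpBound h0 h2).const_mul C)
    (.of_forall fun y => hC x y)

theorem coe_derivCLM (f : 𝓢(ℝ, ℝ)) : (⇑(SchwartzMap.derivCLM ℝ ℝ f) : ℝ → ℝ) = deriv f := by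
  ext x; exact SchwartzMap.derivCLM_apply ℝ f x

/-- `(L f)' = L f'` for a Schwartz function `f`. -/
theorem hasDerivAt_levyOp (cp cm : ℝ) {α : ℝ} (h0 : 0 < α) (h2 : α < 2) (f : 𝓢(ℝ, ℝ)) (x : ℝ) :
    HasDerivAt (levyOp cp cm α f) (levyOp cp cm α (SchwartzMap.derivCLM ℝ ℝ f) x) x := by
  obtain ⟨C, -, hC⟩ := levyIntegrand_bound cp cm α (SchwartzMap.derivCLM ℝ ℝ f)
  refine (hasDerivAt_integral_of_dominated_loc_of_deriv_le (s := Set.univ)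
    (F := levyIntegrand cp cm α f) (F' := levyIntegrand cp cm α (SchwartzMap.derivCLM ℝ ℝ f))
    (bound := fun y => C * jumpBound α y) Filter.univ_mem
    (.of_forall fun z => (integrable_levyIntegrand cp cm h0 h2 f z).aestronglyMeasurable)
    (integrable_levyIntegrand cp cm h0 h2 f x)
    (integrable_levyIntegrand cp cm h0 h2 _ x).aestronglyMeasurable
    (.of_forall fun y z _ => hC z y) ((integrable_jumpBound h0 h2).const_mul C)
    (.of_forall fun y z _ => ?_)).2
  unfold levyIntegrand
  rw [coe_derivCLM]
  have d0 : Differentiable ℝ f := f.differentiable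
  have d1 : Differentiable ℝ (deriv f) := by
    rw [← coe_derivCLM]; exact (SchwartzMap.derivCLM ℝ ℝ f).differentiable
  exact ((((d0 (z + y)).hasDerivAt.comp_add_const z y).sub (d0 z).hasDerivAt).sub
    ((d1 z).hasDerivAt.const_mul _)).const_mul _

theorem iteratedDeriv_levyOp (cp cm : ℝ) {α : ℝ} (h0 : 0 < α) (h2 : α < 2) (n : ℕ) :
    ∀ f : 𝓢(ℝ, ℝ), ∃ g : 𝓢(ℝ, ℝ),
      iteratedDeriv n (levyOp cp cm α f) = levyOp cp cm α g := by
  induction n with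
  | zero => exact fun f => ⟨f, by simp⟩
  | succ n ih =>
    intro f
    obtain ⟨g, hg⟩ := ih (SchwartzMap.derivCLM ℝ ℝ f)
    refine ⟨g, ?_⟩
    rw [iteratedDeriv_succ', ← hg]
    congr 1
    ext x
    exact (hasDerivAt_levyOp cp cm h0 h2 f x).deriv

/-- For a Schwartz function `f` the function `L f` is smooth, with bounded derivatives; in
particular its product with a Schwartz function is a Schwartz function. -/
theorem hasTemperateGrowth_levyOp (cp cm : ℝ) {α : ℝ} (h0 : 0 < α) (h2 : α < 2) (f : 𝓢(ℝ, ℝ)) :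
    (levyOp cp cm α f).HasTemperateGrowth := by
  refine ⟨contDiff_of_differentiable_iteratedDeriv fun m _ => ?_, fun n => ?_⟩
  · obtain ⟨g, hg⟩ := iteratedDeriv_levyOp cp cm h0 h2 m f
    rw [hg]
    exact fun x => (hasDerivAt_levyOp cp cm h0 h2 g x).differentiableAt
  · obtain ⟨g, hg⟩ := iteratedDeriv_levyOp cp cm h0 h2 n f
    obtain ⟨C, hC⟩ := levyOp_bounded cp cm h0 h2 g
    refine ⟨0, C, fun x => ?_⟩
    rw [norm_iteratedFDeriv_eq_norm_iteratedDeriv, hg]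
    simpa using hC x

/-- The duality `⟨L(cp, cm; α) f, g⟩ = ⟨f, L(cm, cp; α) g⟩` in `L²(ℝ)`. -/
theorem integral_levyOp_mul (cp cm : ℝ) {α : ℝ} (h0 : 0 < α) (h2 : α < 2) (f g : 𝓢(ℝ, ℝ)) :
    ∫ x, levyOp cp cm α f x * g x = ∫ x, f x * levyOpAdj cp cm α g x := by
  have hint : ∀ (a b : ℝ) (u v : 𝓢(ℝ, ℝ)), Integrable
      (Function.uncurry fun x y => levyIntegrand a b α u x y * v x) (volume.prod volume) := by
    intro a b u v
    obtain ⟨C, -, hC⟩ := levyIntegrand_bound a b α u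
    have hv : Integrable (fun x => v x) := v.integrable
    refine (hv.norm.mul_prod ((integrable_jumpBound h0 h2).const_mul C)).mono' ?_ ?_
    · exact ((measurable_levyIntegrand a b α u).mul
        (v.continuous.measurable.comp measurable_fst)).aestronglyMeasurable
    · refine .of_forall fun p => ?_
      simp only [Function.uncurry, norm_mul, Real.norm_eq_abs]
      rw [mul_comm]
      exact mul_le_mul_of_nonneg_left (hC p.1 p.2) (abs_nonneg _)
  have hswap : ∀ (a b : ℝ) (u v : 𝓢(ℝ, ℝ)), ∫ x, levyOp a b α u x * v x
      = ∫ y, jumpCoeff a b y / |y| ^ (1 + α) *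
        ∫ x, (u (x + y) - u x - centering α y * deriv u x) * v x := by
    intro a b u v
    simp_rw [levyOp, ← integral_mul_const]
    rw [integral_integral_swap (hint a b u v)]
    refine integral_congr_ae (.of_forall fun y => ?_)
    simp only [levyIntegrand]
    rw [← integral_const_mul]
    refine integral_congr_ae (.of_forall fun x => ?_)
    simp only
    ring
  have hmul : ∀ u v : 𝓢(ℝ, ℝ), ∀ y : ℝ, Integrable (fun x => u (x + y) * v x) := by
    intro u v y
    obtain ⟨C, -, hC⟩ := schwartz_bounded u
    have hv : Integrable (fun x => v x) := v.integrable
    exact hv.bdd_mul (c := C) (u.continuous.comp (by fun_prop)).aestronglyMeasurable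
      (.of_forall fun x => hC _)
  have hexp : ∀ (u v : 𝓢(ℝ, ℝ)) (y : ℝ),
      ∫ x, (u (x + y) - u x - centering α y * deriv u x) * v x
      = (∫ x, u (x + y) * v x) - (∫ x, u x * v x) - centering α y * ∫ x, deriv u x * v x := by
    intro u v y
    have e1 := hmul u v y
    have e2 : Integrable (fun x => u x * v x) := by simpa using hmul u v 0
    have e3 : Integrable (fun x => deriv u x * v x) := by
      simpa [coe_derivCLM] using hmul (SchwartzMap.derivCLM ℝ ℝ u) v 0
    have e12 : Integrable (fun x => u (x + y) * v x - u x * v x) := e1.sub e2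
    rw [← integral_sub e1 e2, ← integral_const_mul, ← integral_sub e12 (e3.const_mul _)]
    refine integral_congr_ae (.of_forall fun x => ?_)
    simp only
    ring
  have hcomm : ∫ x, f x * levyOpAdj cp cm α g x = ∫ x, levyOp cm cp α g x * f x := by
    simp_rw [levyOpAdj, mul_comm]
  rw [hcomm, hswap, hswap, ← integral_neg_eq_self]
  refine integral_congr_ae (.of_forall fun y => ?_)
  simp only [abs_neg]
  have hj : jumpCoeff cp cm (-y) = jumpCoeff cm cp y := by
    unfold jumpCoeff
    rcases lt_trichotomy y 0 with h | h | h
    · simp [h, not_lt.2 h.le]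
    · simp [h]
    · simp [h, not_lt.2 h.le]
  have hc : centering α (-y) = - centering α y := by
    unfold centering
    rw [abs_neg]
    split_ifs <;> simp
  rw [hj, hexp, hexp, hc]
  congr 1
  have t1 : ∫ x, f (x + -y) * g x = ∫ x, g (x + y) * f x := by
    rw [← integral_add_right_eq_self _ y]
    refine integral_congr_ae (.of_forall fun x => ?_)
    simp [mul_comm]
  have t2 : ∫ x, f x * g x = ∫ x, g x * f x := by simp_rw [mul_comm]
  have t3 : ∫ x, deriv g x * f x = - ∫ x, deriv f x * g x := by
    rw [← SchwartzMap.integral_mul_deriv_eq_neg_deriv_mul f g]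
    simp_rw [mul_comm]
  rw [t1, t2, t3]
  ring

/-! ### The Gaussian cutoff -/

theorem iteratedDeriv_gaussian (b : ℝ) (n : ℕ) : ∃ p : Polynomial ℝ,
    iteratedDeriv n (fun x : ℝ => Real.exp (-b * x ^ 2))
      = fun x => p.eval x * Real.exp (-b * x ^ 2) := by
  induction n with
  | zero => exact ⟨1, by simp⟩
  | succ n ih =>
    obtain ⟨p, hp⟩ := ih
    refine ⟨p.derivative - Polynomial.C (2 * b) * Polynomial.X * p, ?_⟩
    rw [iteratedDeriv_succ, hp]
    ext x
    have h1 : HasDerivAt (fun x : ℝ => Real.exp (-b * x ^ 2))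
        (Real.exp (-b * x ^ 2) * (-b * (2 * x))) x := by
      have := ((hasDerivAt_pow 2 x).const_mul (-b)).exp
      simpa using this
    have h2 := ((p.hasDerivAt x).mul h1).deriv
    refine Eq.trans h2 ?_
    simp
    ring

theorem gaussian_decay {b : ℝ} (hb : 0 < b) (k : ℕ) (p : Polynomial ℝ) :
    ∃ C : ℝ, ∀ x : ℝ, |x| ^ k * |p.eval x * Real.exp (-b * x ^ 2)| ≤ C := by
  have hmon : ∀ m : ℕ, ∃ C : ℝ, ∀ x : ℝ, |x| ^ m * Real.exp (-b * x ^ 2) ≤ C := by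
    intro m
    have ht := tendsto_rpow_abs_mul_exp_neg_mul_sq_cocompact hb m
    simp_rw [Real.rpow_natCast] at ht
    have hcont : Continuous fun x : ℝ => |x| ^ m * Real.exp (-b * x ^ 2) := by fun_prop
    obtain ⟨C, hC⟩ := (ZeroAtInftyContinuousMap.mk ⟨_, hcont⟩ ht).isBounded_range.bddAbove
    exact ⟨C, fun x => hC ⟨x, rfl⟩⟩
  induction p using Polynomial.induction_on' generalizing k with
  | add p q hp hq =>
    obtain ⟨C, hC⟩ := hp k
    obtain ⟨D, hD⟩ := hq k
    refine ⟨C + D, fun x => ?_⟩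
    rw [Polynomial.eval_add, add_mul]
    calc _ ≤ |x| ^ k * (|p.eval x * Real.exp (-b * x ^ 2)| + |q.eval x * Real.exp (-b * x ^ 2)|) := by
          gcongr; exact abs_add_le _ _
      _ ≤ _ := by rw [mul_add]; exact add_le_add (hC x) (hD x)
  | monomial m a =>
    obtain ⟨C, hC⟩ := hmon (k + m)
    refine ⟨|a| * C, fun x => ?_⟩
    rw [Polynomial.eval_monomial, abs_mul, abs_mul, Real.abs_exp, abs_pow]
    calc _ = |a| * (|x| ^ (k + m) * Real.exp (-b * x ^ 2)) := by ring
      _ ≤ _ := by gcongr; exact hC x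

/-- The Schwartz function `ψ_ε(x) = exp(-(εx)²)`, for `ε > 0` (and `0` otherwise). -/
noncomputable def gaussCutoff (ε : ℝ) : 𝓢(ℝ, ℝ) :=
  if h : 0 < ε then
    { toFun := fun x => Real.exp (-ε ^ 2 * x ^ 2)
      smooth' := by fun_prop
      decay' := fun k n => by
        obtain ⟨p, hp⟩ := iteratedDeriv_gaussian (ε ^ 2) n
        obtain ⟨C, hC⟩ := gaussian_decay (show 0 < ε ^ 2 by positivity) k p
        refine ⟨C, fun x => ?_⟩
        rw [norm_iteratedFDeriv_eq_norm_iteratedDeriv, hp]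
        exact hC x }
  else 0

/-- The Schwartz function `ψ_ε L f`, for `ε > 0` and a Schwartz function `f`. -/
noncomputable def cutLevy (cp cm α ε : ℝ) (f : 𝓢(ℝ, ℝ)) : 𝓢(ℝ, ℝ) :=
  SchwartzMap.smulLeftCLM ℝ (levyOp cp cm α f) (gaussCutoff ε)

theorem cutLevy_apply (cp cm : ℝ) {α ε : ℝ} (h0 : 0 < α) (h2 : α < 2) (hε : 0 < ε)
    (f : 𝓢(ℝ, ℝ)) (x : ℝ) :
    cutLevy cp cm α ε f x = Real.exp (-(ε * x) ^ 2) * levyOp cp cm α f x := by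
  unfold cutLevy gaussCutoff
  rw [SchwartzMap.smulLeftCLM_apply_apply (hasTemperateGrowth_levyOp cp cm h0 h2 f), dif_pos hε]
  change levyOp cp cm α f x * Real.exp (-ε ^ 2 * x ^ 2) = _
  rw [mul_comm, neg_mul, mul_pow]

/-! ### Random tempered distributions -/

/-- Real tempered distributions on the line, with the weak-`*` topology. -/
abbrev TemperedDist : Type := WeakDual ℝ 𝓢(ℝ, ℝ)

/-- The cylindrical σ-algebra on the space of tempered distributions, generated by the
evaluations `ω ↦ ω(f)`. -/
noncomputable instance instMeasurableSpaceTemperedDist : MeasurableSpace TemperedDist :=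
  ⨆ f : 𝓢(ℝ, ℝ), MeasurableSpace.comap (fun ω : TemperedDist => ω f) (borel ℝ)

/-- The random distribution `X` is a white noise of variance `χ`: each `X(f)` is a Gaussian
variable with mean `0` and variance `χ ‖f‖²`. -/
def IsWhiteNoise {Ω : Type*} [MeasurableSpace Ω] (P : Measure Ω) (χ : ℝ) (X : Ω → TemperedDist) :
    Prop :=
  Measurable X ∧ ∀ f : 𝓢(ℝ, ℝ),
    HasLaw (fun ω => X ω f) (gaussianReal 0 (χ * ∫ x, f x ^ 2).toNNReal) P

/-- `f : [0,T] → 𝓢(ℝ)` is continuously differentiable with derivative `f'`, the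
difference quotients converging in the topology of the Schwartz space. -/
def IsTestTrajectory (T : ℝ) (f f' : Set.Icc (0 : ℝ) T → 𝓢(ℝ, ℝ)) : Prop :=
  Continuous f' ∧ ∀ t : Set.Icc (0 : ℝ) T,
    Tendsto (fun s : Set.Icc (0 : ℝ) T => ((s : ℝ) - t)⁻¹ • (f s - f t)) (𝓝[≠] t) (𝓝 (f' t))

section Solutions

variable {Ω : Type*} [mΩ : MeasurableSpace Ω] {T : ℝ}

/-- Lebesgue measure on the time interval `[0,T]`. -/
noncomputable def timeMeasure (T : ℝ) : Measure (Set.Icc (0 : ℝ) T) :=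
  Measure.comap Subtype.val volume

/-- The time `0`, as an element of `[0,T]`. -/
def initialTime (hT : 0 < T) : Set.Icc (0 : ℝ) T := ⟨0, Set.left_mem_Icc.2 hT.le⟩

/-- The σ-algebra generated by the process up to time `t` and by the null sets. -/
noncomputable abbrev pastSigma (P : Measure Ω) (Y : Set.Icc (0 : ℝ) T → Ω → TemperedDist)
    (t : Set.Icc (0 : ℝ) T) : MeasurableSpace Ω :=
  (⨆ s, ⨆ _ : s ≤ t, MeasurableSpace.comap (Y s) inferInstance) ⊔
    MeasurableSpace.generateFrom {A | MeasurableSet A ∧ P A = 0}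

/-- The natural filtration of a process, completed by the null sets. -/
noncomputable def naturalFiltration (P : Measure Ω) (Y : Set.Icc (0 : ℝ) T → Ω → TemperedDist)
    (hY : ∀ t, Measurable (Y t)) : Filtration (Set.Icc (0 : ℝ) T) mΩ where
  seq := pastSigma P Y
  mono' _ _ hst := sup_le_sup_right
    (biSup_mono fun _ hr => le_trans hr hst) _
  le' _ := sup_le (iSup₂_le fun s _ => (hY s).comap_le)
    (MeasurableSpace.generateFrom_le fun _ hA => hA.1)

/-- The random variable `I` is (a version of) `∫_0^t Y_s(L f_s) ds`, that is, the limit in `L²(P)`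
of `∫_0^t Y_s(ψ_ε L f_s) ds` as `ε → 0`. -/
def IsDriftIntegral (cp cm α : ℝ) (P : Measure Ω) (Y : Set.Icc (0 : ℝ) T → Ω → TemperedDist)
    (f : Set.Icc (0 : ℝ) T → 𝓢(ℝ, ℝ)) (t : Set.Icc (0 : ℝ) T) (I : Ω → ℝ) : Prop :=
  MemLp I 2 P ∧
  Tendsto (fun ε : ℝ => eLpNorm
    (fun ω => (∫ s in Set.Iic t, Y s ω (cutLevy cp cm α ε (f s)) ∂timeMeasure T) - I ω) 2 P) (𝓝[>] 0) (𝓝 0)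

/-- The real process `M` is a continuous martingale with deterministic quadratic variation `A`
(null at time `0`): it has continuous paths, and `M` and `M² - A` are martingales. -/
def IsContMartingaleWithQV (P : Measure Ω) (ℱ : Filtration (Set.Icc (0 : ℝ) T) mΩ)
    (M : Set.Icc (0 : ℝ) T → Ω → ℝ) (A : Set.Icc (0 : ℝ) T → ℝ) : Prop :=
  (∀ᵐ ω ∂P, Continuous fun t => M t ω) ∧ Martingale M ℱ P ∧
  Martingale (fun t ω => M t ω ^ 2 - A t) ℱ P

/-- `Y` is a stationary solution on `[0,T]` of the Ornstein-Uhlenbeck equation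
`dY = L^* Y dt + √(2χ(-S)) dW`: each `Y_t` is a white noise of variance `χ`, and for every
continuously differentiable `f : [0,T] → 𝓢(ℝ)` the process
`Y_t(f_t) - Y_0(f_0) - ∫_0^t Y_s((∂_s + L) f_s) ds` has a version which is a continuous martingale
of quadratic variation `2χ ∫_0^t ⟨f_s, -S f_s⟩ ds`. -/
structure IsStationarySolution (hT : 0 < T) (cp cm α χ : ℝ) (P : Measure Ω)
    (Y : Set.Icc (0 : ℝ) T → Ω → TemperedDist) : Prop where
  measurable : Measurable (Function.uncurry Y)
  whiteNoise : ∀ t, IsWhiteNoise P χ (Y t)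
  martingale : ∀ f f' : Set.Icc (0 : ℝ) T → 𝓢(ℝ, ℝ), IsTestTrajectory T f f' →
    ∃ I M : Set.Icc (0 : ℝ) T → Ω → ℝ,
      (∀ t, IsDriftIntegral cp cm α P Y f t (I t)) ∧
      (∀ t, ∀ᵐ ω ∂P, M t ω = Y t ω (f t) - Y (initialTime hT) ω (f (initialTime hT)) - ((∫ s in Set.Iic t, Y s ω (f' s) ∂timeMeasure T)
          + I t ω)) ∧
      IsContMartingaleWithQV P (naturalFiltration P Y fun t => (whiteNoise t).1) M
        (fun t => 2 * χ *
          ∫ s in Set.Iic t, (∫ x, f s x * -levySym cp cm α (f s) x) ∂timeMeasure T)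

end Solutions

end StableOU

/-! The law of a solution is determined by the characteristic functions of the finite sums `∑ Y_t(F
t)`, and these are compared for two solutions by induction on the number of times. Let `t` be the
last time and `s` the one before. If a trajectory `f_r` solved the backward equation `∂_r f_r + L
f_r = 0` with `f_t = F t`, the drift would vanish and `Y_t(F t) = Y_s(f_s) + (M_t - M_s)`, where `M`
is the martingale of the trajectory. The term `Y_s(f_s)` is absorbed in the test function at time
`s`. The increment is that of a continuous martingale whose quadratic variation is deterministic and
the same for both solutions, so by Lévy's argument its conditional characteristic function given the
past is the same too. This reduces the number of times by one; a single time is settled by the white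
noise condition.

The exact backward solution is in general not Schwartz, because the jumps have heavy tails. An error
of size `δ` in `L²(ℝ)` is harmless, since the white noise condition turns it into an error of order
`δ` in `L²(P)`. Approximate solutions come from the fact that `L f` lies in the closed convex cone
of `L²(ℝ)` generated by the increments `f(· + y) - f` (`exists_jump_approx`, by separation). Choose
a compound Poisson generator `G = J - λ`, with `J = ∑ a(y) f(· + y)` and `λ = ∑ a(y)`, such that `G
f` is close to `L f`. Both commute with translations and `exp(uG)` is an average of translations, so
`(L - G) exp(uG) f` is no larger than `(L - G) f`. Truncating the exponential series leaves finitely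
many Schwartz functions with scalar coefficients (`exists_approx_backward`).

Lévy's argument (`IsL4Martingale.tendsto_integral_mul_exp`) is a second order expansion of the
exponential along partitions. It uses fourth moments, which come from the Gaussian marginals, and
continuity of paths. -/

namespace StableOU

/-! ### Translations on the Schwartz space and on `L²(ℝ)`. -/

/-- The real Hilbert space `L²(ℝ)`. -/
abbrev L2Line : Type := Lp ℝ 2 (volume : Measure ℝ)

/-- The inclusion of the Schwartz space in `L²(ℝ)`. -/
noncomputable abbrev schwartzToL2 : 𝓢(ℝ, ℝ) →L[ℝ] L2Line :=
  SchwartzMap.toLpCLM ℝ ℝ 2 volume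

/-- The translation `f ↦ f(· + y)` on the Schwartz space. -/
noncomputable def shift (y : ℝ) : 𝓢(ℝ, ℝ) →L[ℝ] 𝓢(ℝ, ℝ) :=
  SchwartzMap.compSubConstCLM ℝ (-y)

@[simp] theorem shift_apply (y : ℝ) (f : 𝓢(ℝ, ℝ)) (x : ℝ) : shift y f x = f (x + y) := by
  simp [shift]

/-- The translation `u ↦ u(· + y)` on `L²(ℝ)`. -/
noncomputable def shiftL2 (y : ℝ) : L2Line →ₗᵢ[ℝ] L2Line :=
  Lp.compMeasurePreservingₗᵢ ℝ (fun x => x + y) (measurePreserving_add_right volume y)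

theorem coeFn_schwartzToL2 (f : 𝓢(ℝ, ℝ)) : schwartzToL2 f =ᵐ[volume] f :=
  SchwartzMap.coeFn_toLp f 2 volume

theorem coeFn_shiftL2 (y : ℝ) (u : L2Line) : shiftL2 y u =ᵐ[volume] fun x => u (x + y) :=
  Lp.coeFn_compMeasurePreserving u (measurePreserving_add_right volume y)

theorem ae_add_right {p : ℝ → Prop} (h : ∀ᵐ x, p x) (y : ℝ) : ∀ᵐ x : ℝ, p (x + y) :=
  (measurePreserving_add_right volume y).quasiMeasurePreserving.ae h

theorem schwartzToL2_shift (y : ℝ) (f : 𝓢(ℝ, ℝ)) :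
    schwartzToL2 (shift y f) = shiftL2 y (schwartzToL2 f) := by
  apply Lp.ext
  filter_upwards [coeFn_schwartzToL2 (shift y f), coeFn_shiftL2 y (schwartzToL2 f),
    ae_add_right (coeFn_schwartzToL2 f) y] with x h1 h2 h3
  rw [h1, h2, h3, shift_apply]

/-- Strong continuity of translations on `L²(ℝ)`; it provides the measurability in `y` needed to
integrate jump increments as `L²`-valued functions. -/
theorem continuous_schwartzToL2_shift (f : 𝓢(ℝ, ℝ)) :
    Continuous fun y => schwartzToL2 (shift y f) := by
  simp_rw [schwartzToL2_shift]
  have hg : Continuous fun y : ℝ => (ContinuousMap.mk (fun x : ℝ => x + y) (by fun_prop)) := by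
    refine ContinuousMap.continuous_of_continuous_uncurry _ ?_
    simp only [Function.uncurry_def, ContinuousMap.coe_mk]
    fun_prop
  exact Continuous.compMeasurePreservingLp (f := fun _ => schwartzToL2 f) continuous_const hg
    (fun y => measurePreserving_add_right volume y) (by norm_num)

/-! ### Taylor remainders in `L²(ℝ)` and the generator as a Bochner integral. -/

theorem memLp_inv_one_add_sq : MemLp (fun x : ℝ => (1 + x ^ 2)⁻¹) 2 volume := by
  rw [memLp_two_iff_integrable_sq (by fun_prop)]
  refine integrable_inv_one_add_sq.mono' (by fun_prop) (.of_forall fun x => ?_)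
  have : (1 + x ^ 2)⁻¹ ≤ 1 := inv_le_one_of_one_le₀ (by nlinarith [sq_nonneg x])
  have h0 : 0 ≤ (1 + x ^ 2)⁻¹ := by positivity
  rw [Real.norm_eq_abs, abs_of_nonneg (by positivity)]
  nlinarith

theorem abs_le_inv_one_add_sq (f : 𝓢(ℝ, ℝ)) :
    ∃ C, 0 ≤ C ∧ ∀ x, |f x| ≤ C * (1 + x ^ 2)⁻¹ := by
  obtain ⟨C0, h0, H0⟩ := f.decay 0 0
  obtain ⟨C2, h2, H2⟩ := f.decay 2 0
  refine ⟨C0 + C2, by positivity, fun x => ?_⟩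
  have a := H0 x
  have b := H2 x
  simp only [norm_iteratedFDeriv_zero, Real.norm_eq_abs, pow_zero, one_mul, sq_abs] at a b
  rw [← div_eq_mul_inv, le_div_iff₀ (by positivity)]
  linarith

theorem abs_le_inv_one_add_sq_of_abs_sub_le (f : 𝓢(ℝ, ℝ)) :
    ∃ C, 0 ≤ C ∧ ∀ x z, |z - x| ≤ 1 → |f z| ≤ C * (1 + x ^ 2)⁻¹ := by
  obtain ⟨C, hC, H⟩ := abs_le_inv_one_add_sq f
  -- If `|z - x| ≤ 1` then `1 + x² ≤ 3 (1 + z²)`: the weight at `z` is comparable to that at `x`.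
  refine ⟨3 * C, by positivity, fun x z hz => (H z).trans ?_⟩
  rw [mul_comm 3, mul_assoc]
  refine mul_le_mul_of_nonneg_left ?_ hC
  rw [← div_eq_mul_inv, inv_eq_one_div, div_le_div_iff₀ (by positivity) (by positivity)]
  have := abs_le.1 hz
  nlinarith [sq_nonneg (x + z), sq_nonneg (2 * z - x)]

/-- The mean value inequality on the segment from `x` to `x + y`, for `f` and for `z ↦ f z - (z - x)
f'(x)`. Compared with `taylor_bound` the remainders also decay in `x`, which makes them square
integrable; the condition `|y| ≤ 1` keeps the weight comparable along the segment. -/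
theorem abs_taylor_sub_le (f : 𝓢(ℝ, ℝ)) : ∃ C, 0 ≤ C ∧ ∀ x y, |y| ≤ 1 →
    |f (x + y) - f x| ≤ C * |y| * (1 + x ^ 2)⁻¹ ∧
    |f (x + y) - f x - y * SchwartzMap.derivCLM ℝ ℝ f x| ≤ C * |y| ^ 2 * (1 + x ^ 2)⁻¹ := by
  have first : ∀ g : 𝓢(ℝ, ℝ), ∃ C, 0 ≤ C ∧ ∀ x y, |y| ≤ 1 →
      |g (x + y) - g x| ≤ C * |y| * (1 + x ^ 2)⁻¹ := by
    intro g
    obtain ⟨C, hC, H⟩ := abs_le_inv_one_add_sq_of_abs_sub_le (SchwartzMap.derivCLM ℝ ℝ g)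
    refine ⟨C, hC, fun x y hy => ?_⟩
    have := Convex.norm_image_sub_le_of_norm_deriv_le (f := g) (s := Set.uIcc x (x + y))
      (x := x) (y := x + y) (C := C * (1 + x ^ 2)⁻¹) (fun z _ => g.differentiable z)
      (fun z hz => by
        rw [← SchwartzMap.derivCLM_apply ℝ]
        have := Set.abs_sub_left_of_mem_uIcc hz
        exact H x z (by simpa using this.trans (by simpa using hy))) (convex_uIcc _ _)
      Set.left_mem_uIcc Set.right_mem_uIcc
    simp only [add_sub_cancel_left, Real.norm_eq_abs] at this
    linarith
  obtain ⟨C1, h1, H1⟩ := first f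
  obtain ⟨C2, h2, H2⟩ := first (SchwartzMap.derivCLM ℝ ℝ f)
  refine ⟨C1 + C2, by positivity, fun x y hy => ⟨?_, ?_⟩⟩
  · refine (H1 x y hy).trans ?_
    gcongr
    linarith
  · set d := SchwartzMap.derivCLM ℝ ℝ f with hd
    have hder : ∀ z, HasDerivAt (fun z => f z - (z - x) * d x) (d z - d x) z := by
      intro z
      have := (f.differentiable z).hasDerivAt.sub
        (((hasDerivAt_id z).sub_const x).mul_const (d x))
      rw [one_mul, ← SchwartzMap.derivCLM_apply ℝ] at this
      exact this
    have hb : ∀ z ∈ Set.uIcc x (x + y), ‖d z - d x‖ ≤ C2 * |y| * (1 + x ^ 2)⁻¹ := by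
      intro z hz
      have h' : |z - x| ≤ |y| := by
        have := Set.abs_sub_left_of_mem_uIcc hz
        simpa using this
      have h := H2 x (z - x) (h'.trans hy)
      rw [show x + (z - x) = z by ring] at h
      rw [Real.norm_eq_abs]
      refine h.trans ?_
      gcongr
    have := Convex.norm_image_sub_le_of_norm_hasDerivWithin_le
      (f := fun z => f z - (z - x) * d x) (s := Set.uIcc x (x + y))
      (fun z _ => (hder z).hasDerivWithinAt) hb (convex_uIcc _ _)
      Set.left_mem_uIcc Set.right_mem_uIcc
    simp only [add_sub_cancel_left, Real.norm_eq_abs, sub_self, zero_mul, sub_zero] at this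
    rw [show f (x + y) - f x - y * d x = f (x + y) - y * d x - f x by ring]
    refine this.trans (le_of_eq_of_le (b := C2 * |y| ^ 2 * (1 + x ^ 2)⁻¹) (by ring) ?_)
    gcongr
    linarith

theorem exists_norm_schwartzToL2_le : ∃ K, 0 ≤ K ∧ ∀ (h : 𝓢(ℝ, ℝ)) (C : ℝ),
    (∀ x, |h x| ≤ C * (1 + x ^ 2)⁻¹) → ‖schwartzToL2 h‖ ≤ C * K := by
  refine ⟨‖memLp_inv_one_add_sq.toLp‖, norm_nonneg _, fun h C hC => ?_⟩
  refine Lp.norm_le_mul_norm_of_ae_le_mul ?_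
  filter_upwards [coeFn_schwartzToL2 h, memLp_inv_one_add_sq.coeFn_toLp] with x h1 h2
  rw [h1, h2, Real.norm_eq_abs, Real.norm_eq_abs, abs_of_nonneg (a := (1 + x ^ 2)⁻¹) (by positivity)]
  exact hC x

/-- The jump increment `f(· + y) - f - θ(y) f'`, compensated by the centering, in `L²(ℝ)`. -/
noncomputable def jumpIncr (θ : ℝ) (f : 𝓢(ℝ, ℝ)) (y : ℝ) : L2Line :=
  schwartzToL2 (shift y f) - schwartzToL2 f - θ • schwartzToL2 (SchwartzMap.derivCLM ℝ ℝ f)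

/-- For small jumps this is the weighted Taylor estimate; for large ones only the isometry of
translations is used. -/
theorem norm_jumpIncr_le (f : 𝓢(ℝ, ℝ)) : ∃ C, 0 ≤ C ∧ ∀ y,
    ‖jumpIncr 0 f y‖ ≤ C ∧ ‖schwartzToL2 (SchwartzMap.derivCLM ℝ ℝ f)‖ ≤ C ∧
    (|y| ≤ 1 → ‖jumpIncr 0 f y‖ ≤ C * |y| ∧ ‖jumpIncr y f y‖ ≤ C * |y| ^ 2) := by
  obtain ⟨C, hC, H⟩ := abs_taylor_sub_le f
  obtain ⟨K, hK, HK⟩ := exists_norm_schwartzToL2_le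
  set d := SchwartzMap.derivCLM ℝ ℝ f with hd
  set n0 := ‖schwartzToL2 f‖
  set n1 := ‖schwartzToL2 d‖
  have hn0 : 0 ≤ n0 := norm_nonneg _
  have hn1 : 0 ≤ n1 := norm_nonneg _
  refine ⟨2 * n0 + n1 + C * K, by positivity, fun y => ⟨?_, ?_, fun hy => ⟨?_, ?_⟩⟩⟩
  · rw [jumpIncr, zero_smul, sub_zero]
    refine (norm_sub_le _ _).trans ?_
    rw [schwartzToL2_shift, LinearIsometry.norm_map]
    have : 0 ≤ C * K := by positivity
    change n0 + n0 ≤ _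
    linarith
  · have : 0 ≤ C * K := by positivity
    change n1 ≤ _
    linarith
  · have h := HK (shift y f - f) (C * |y|) fun x => by simpa using (H x y hy).1
    rw [jumpIncr, zero_smul, sub_zero, ← map_sub]
    refine h.trans ?_
    have : 0 ≤ (2 * n0 + n1) * |y| := by positivity
    linarith
  · have h := HK (shift y f - f - y • d) (C * |y| ^ 2) fun x => by simpa using (H x y hy).2
    rw [jumpIncr, ← map_sub, ← map_smul, ← map_sub]
    refine h.trans ?_
    have : 0 ≤ (2 * n0 + n1) * |y| ^ 2 := by positivity
    linarith

theorem norm_smul_jumpIncr_le (cp cm α : ℝ) (f : 𝓢(ℝ, ℝ)) : ∃ C, 0 ≤ C ∧ ∀ y,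
    ‖(jumpCoeff cp cm y / |y| ^ (1 + α)) • jumpIncr (centering α y) f y‖ ≤ C * jumpBound α y := by
  obtain ⟨C, hC, H⟩ := norm_jumpIncr_le f
  -- The factor 2 is needed only when `α > 1` and `|y| > 1`, where the increment and its compensator
  -- are bounded separately by `C + C |y| ≤ 2 C |y|`.
  refine ⟨(|cp| + |cm|) * (2 * C), by positivity, fun y => ?_⟩
  obtain ⟨Ha, Hc, Hs⟩ := H y
  have hj : |jumpCoeff cp cm y| ≤ |cp| + |cm| := by
    unfold jumpCoeff
    split_ifs
    · linarith [abs_nonneg cm]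
    · linarith [abs_nonneg cp]
    · simp; positivity
  rcases eq_or_ne y 0 with rfl | hy
  · simp only [jumpCoeff, lt_self_iff_false, if_false, zero_div, zero_smul, norm_zero]
    exact mul_nonneg (by positivity) (jumpBound_nonneg _ _)
  have hy' : 0 < |y| := abs_pos.2 hy
  have hp : 0 < |y| ^ (1 + α) := Real.rpow_pos_of_pos hy' _
  suffices hs : ‖jumpIncr (centering α y) f y‖ ≤ (2 * C) * (jumpBound α y * |y| ^ (1 + α)) by
    rw [norm_smul, Real.norm_eq_abs, abs_div, abs_of_pos hp, div_mul_eq_mul_div, div_le_iff₀ hp]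
    calc _ ≤ (|cp| + |cm|) * ((2 * C) * (jumpBound α y * |y| ^ (1 + α))) := by gcongr
      _ = _ := by ring
  have hpow : ∀ a : ℝ, |y| ^ (a - 1 - α) * |y| ^ (1 + α) = |y| ^ a := by
    intro a
    rw [← Real.rpow_add hy']
    congr 1
    ring
  have hsplit : |y| ^ 2 = |y| ^ (2 : ℝ) := by norm_cast
  have hC1 : 0 ≤ C * |y| := by positivity
  have hC2 : 0 ≤ C * |y| ^ 2 := by positivity
  unfold jumpBound centering
  by_cases h1 : |y| ≤ 1
  · obtain ⟨Hb, Hd⟩ := Hs h1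
    rw [if_pos h1, if_pos h1, hpow]
    rcases lt_trichotomy α 1 with h | h | h
    · simp only [h, if_true, Real.rpow_one]
      linarith
    · simp only [h, lt_irrefl, if_true, if_false, ← hsplit]
      linarith
    · simp only [not_lt.2 h.le, h.ne', if_false, ← hsplit]
      linarith
  · rw [if_neg h1, if_neg h1, hpow]
    rcases lt_trichotomy α 1 with h | h | h
    · simp only [h, h.le, if_true, Real.rpow_zero]
      linarith
    · simp only [h, lt_irrefl, le_refl, if_true, if_false, Real.rpow_zero]
      linarith
    · simp only [not_lt.2 h.le, not_le.2 h, h.ne', if_false, Real.rpow_one]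
      have h3 := norm_sub_le (jumpIncr 0 f y)
        (y • schwartzToL2 (SchwartzMap.derivCLM ℝ ℝ f))
      rw [norm_smul, Real.norm_eq_abs] at h3
      have h4 : jumpIncr 0 f y - y • schwartzToL2 (SchwartzMap.derivCLM ℝ ℝ f)
          = jumpIncr y f y := by simp [jumpIncr]
      rw [h4] at h3
      nlinarith

theorem integrable_smul_jumpIncr (cp cm : ℝ) {α : ℝ} (h0 : 0 < α) (h2 : α < 2) (f : 𝓢(ℝ, ℝ)) :
    Integrable fun y => (jumpCoeff cp cm y / |y| ^ (1 + α)) • jumpIncr (centering α y) f y := by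
  obtain ⟨C, -, hC⟩ := norm_smul_jumpIncr_le cp cm α f
  refine ((integrable_jumpBound h0 h2).const_mul C).mono' ?_ (.of_forall hC)
  have h1 : Measurable fun y : ℝ => jumpCoeff cp cm y / |y| ^ (1 + α) :=
    (measurable_jumpCoeff cp cm).div (measurable_id.abs.pow_const _)
  refine h1.aestronglyMeasurable.smul ?_
  exact ((continuous_schwartzToL2_shift f).aestronglyMeasurable.sub
    aestronglyMeasurable_const).sub
    ((measurable_centering α).aestronglyMeasurable.smul aestronglyMeasurable_const)

/-- Both sides have the same integral over every set of finite measure: the inner product with an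
indicator passes inside the Bochner integral, and Fubini exchanges `x` and `y` on the other side. It
follows that `L f` is in `L²(ℝ)` and that its inner products can be computed jump by jump. -/
theorem levyOp_ae_eq_integral (cp cm : ℝ) {α : ℝ} (h0 : 0 < α) (h2 : α < 2) (f : 𝓢(ℝ, ℝ)) :
    (∫ y, (jumpCoeff cp cm y / |y| ^ (1 + α)) • jumpIncr (centering α y) f y : L2Line)
      =ᵐ[volume] levyOp cp cm α f := by
  have hb := levyOp_bounded cp cm h0 h2 f
  obtain ⟨Cb, hCb⟩ := hb
  have hcont : Continuous (levyOp cp cm α f) :=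
    (show Differentiable ℝ (levyOp cp cm α f) from
      fun x => (hasDerivAt_levyOp cp cm h0 h2 f x).differentiableAt).continuous
  refine ae_eq_of_forall_setIntegral_eq_of_sigmaFinite ?_ ?_ ?_
  · intro s hs hfin
    have : IsFiniteMeasure (volume.restrict s) := ⟨by simpa using hfin⟩
    exact ((Lp.memLp _).restrict s).integrable (by norm_num)
  · intro s hs hfin
    have : IsFiniteMeasure (volume.restrict s) := ⟨by simpa using hfin⟩
    exact Integrable.of_bound hcont.aestronglyMeasurable Cb (.of_forall hCb)
  · intro s hs hfin
    have : IsFiniteMeasure (volume.restrict s) := ⟨by simpa using hfin⟩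
    rw [← L2.inner_indicatorConstLp_one hs hfin.ne, ← integral_inner
      (integrable_smul_jumpIncr cp cm h0 h2 f)]
    simp_rw [L2.inner_indicatorConstLp_one hs hfin.ne]
    obtain ⟨C, -, hC⟩ := levyIntegrand_bound cp cm α f
    have hint : Integrable (Function.uncurry fun x y => levyIntegrand cp cm α f x y)
        ((volume.restrict s).prod volume) := by
      refine (((integrable_const (1 : ℝ)).mul_prod
        ((integrable_jumpBound h0 h2).const_mul C))).mono'
        (measurable_levyIntegrand cp cm α f).aestronglyMeasurable (.of_forall fun p => ?_)
      rw [one_mul]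
      exact hC p.1 p.2
    simp only [levyOp]
    rw [integral_integral_swap hint]
    refine integral_congr_ae (.of_forall fun y => ?_)
    refine integral_congr_ae (ae_restrict_of_ae ?_)
    simp only [jumpIncr]
    filter_upwards [Lp.coeFn_smul (jumpCoeff cp cm y / |y| ^ (1 + α))
        (schwartzToL2 (shift y f) - schwartzToL2 f
          - centering α y • schwartzToL2 (SchwartzMap.derivCLM ℝ ℝ f)),
      Lp.coeFn_sub (schwartzToL2 (shift y f) - schwartzToL2 f)
        (centering α y • schwartzToL2 (SchwartzMap.derivCLM ℝ ℝ f)),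
      Lp.coeFn_sub (schwartzToL2 (shift y f)) (schwartzToL2 f),
      Lp.coeFn_smul (centering α y) (schwartzToL2 (SchwartzMap.derivCLM ℝ ℝ f)),
      coeFn_schwartzToL2 (shift y f), coeFn_schwartzToL2 f,
      coeFn_schwartzToL2 (SchwartzMap.derivCLM ℝ ℝ f)] with x e1 e2 e3 e4 e5 e6 e7
    rw [e1, Pi.smul_apply, e2, Pi.sub_apply, e3, Pi.sub_apply, e4, Pi.smul_apply, e5, e6, e7]
    simp [levyIntegrand]

theorem memLp_levyOp (cp cm : ℝ) {α : ℝ} (h0 : 0 < α) (h2 : α < 2) (f : 𝓢(ℝ, ℝ)) :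
    MemLp (levyOp cp cm α f) 2 volume :=
  (memLp_congr_ae (levyOp_ae_eq_integral cp cm h0 h2 f)).1 (Lp.memLp _)

theorem levyIntegrand_add (cp cm α : ℝ) (f g : 𝓢(ℝ, ℝ)) (x y : ℝ) :
    levyIntegrand cp cm α (f + g) x y
      = levyIntegrand cp cm α f x y + levyIntegrand cp cm α g x y := by
  unfold levyIntegrand
  rw [deriv_add (f.differentiable x) (g.differentiable x)]
  simp only [Pi.add_apply]
  ring

theorem levyOp_add (cp cm : ℝ) {α : ℝ} (h0 : 0 < α) (h2 : α < 2) (f g : 𝓢(ℝ, ℝ)) (x : ℝ) :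
    levyOp cp cm α (f + g : 𝓢(ℝ, ℝ)) x = levyOp cp cm α f x + levyOp cp cm α g x := by
  unfold levyOp
  rw [← integral_add (integrable_levyIntegrand cp cm h0 h2 f x)
    (integrable_levyIntegrand cp cm h0 h2 g x)]
  exact integral_congr_ae (.of_forall fun y => levyIntegrand_add cp cm α f g x y)

theorem levyOp_smul (cp cm α c : ℝ) (f : 𝓢(ℝ, ℝ)) (x : ℝ) :
    levyOp cp cm α (c • f : 𝓢(ℝ, ℝ)) x = c * levyOp cp cm α f x := by
  unfold levyOp
  rw [← integral_const_mul]
  refine integral_congr_ae (.of_forall fun y => ?_)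
  have hd : deriv (⇑(c • f : 𝓢(ℝ, ℝ))) x = c * deriv f x :=
    deriv_const_mul c (f.differentiable x)
  simp only [levyIntegrand, hd, smul_apply, smul_eq_mul]
  ring

theorem levyOp_shift (cp cm α y : ℝ) (f : 𝓢(ℝ, ℝ)) (x : ℝ) :
    levyOp cp cm α (shift y f) x = levyOp cp cm α f (x + y) := by
  unfold levyOp
  refine integral_congr_ae (.of_forall fun z => ?_)
  have : (⇑(shift y f) : ℝ → ℝ) = fun x => f (x + y) := by ext x; simp
  simp only [levyIntegrand, this]
  rw [deriv_comp_add_const]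
  ring_nf

/-- The generator, as a linear map from the Schwartz space to `L²(ℝ)`. -/
noncomputable def levyL2 (cp cm : ℝ) {α : ℝ} (h0 : 0 < α) (h2 : α < 2) :
    𝓢(ℝ, ℝ) →ₗ[ℝ] L2Line where
  toFun f := (memLp_levyOp cp cm h0 h2 f).toLp
  map_add' f g := by
    rw [← MemLp.toLp_add]
    exact MemLp.toLp_congr _ _ (.of_forall fun x => levyOp_add cp cm h0 h2 f g x)
  map_smul' c f := by
    rw [← MemLp.toLp_const_smul]
    exact MemLp.toLp_congr _ _ (.of_forall fun x => levyOp_smul cp cm α c f x)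

theorem coeFn_levyL2 (cp cm : ℝ) {α : ℝ} (h0 : 0 < α) (h2 : α < 2) (f : 𝓢(ℝ, ℝ)) :
    levyL2 cp cm h0 h2 f =ᵐ[volume] levyOp cp cm α f :=
  (memLp_levyOp cp cm h0 h2 f).coeFn_toLp

theorem levyL2_eq_integral (cp cm : ℝ) {α : ℝ} (h0 : 0 < α) (h2 : α < 2) (f : 𝓢(ℝ, ℝ)) :
    levyL2 cp cm h0 h2 f
      = ∫ y, (jumpCoeff cp cm y / |y| ^ (1 + α)) • jumpIncr (centering α y) f y :=
  Lp.ext ((coeFn_levyL2 cp cm h0 h2 f).trans (levyOp_ae_eq_integral cp cm h0 h2 f).symm)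

theorem levyL2_shift (cp cm : ℝ) {α : ℝ} (h0 : 0 < α) (h2 : α < 2) (y : ℝ) (f : 𝓢(ℝ, ℝ)) :
    levyL2 cp cm h0 h2 (shift y f) = shiftL2 y (levyL2 cp cm h0 h2 f) := by
  apply Lp.ext
  filter_upwards [coeFn_levyL2 cp cm h0 h2 (shift y f), coeFn_shiftL2 y (levyL2 cp cm h0 h2 f),
    ae_add_right (coeFn_levyL2 cp cm h0 h2 f) y] with x e1 e2 e3
  rw [e1, e2, e3, levyOp_shift]

/-! ### Approximation of the generator by compound Poisson generators. -/

/-- If `u ∈ L²(ℝ)` has a nonnegative product with all `f(· + y) - f`, then it is orthogonal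
to `f'`. -/
theorem inner_deriv_eq_zero (f : 𝓢(ℝ, ℝ)) (u : L2Line)
    (hu : ∀ y, 0 ≤ inner ℝ (jumpIncr 0 f y) u) :
    inner ℝ (schwartzToL2 (SchwartzMap.derivCLM ℝ ℝ f)) u = 0 := by
  obtain ⟨C, hC, H⟩ := norm_jumpIncr_le f
  set v := schwartzToL2 (SchwartzMap.derivCLM ℝ ℝ f) with hv
  -- The increment is `y f' + O(y²)`, and `y` may have either sign; letting `y` tend to 0 from each
  -- side gives both inequalities.
  have key : ∀ y : ℝ, |y| ≤ 1 → 0 ≤ y * inner ℝ v u + C * ‖u‖ * |y| ^ 2 := by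
    intro y hy
    have h1 : jumpIncr 0 f y = jumpIncr y f y + y • v := by simp [jumpIncr, hv]
    have h2 := hu y
    rw [h1, inner_add_left, real_inner_smul_left] at h2
    have h3 := real_inner_le_norm (jumpIncr y f y) u
    have h4 := mul_le_mul_of_nonneg_right ((H y).2.2 hy).2 (norm_nonneg u)
    nlinarith
  have hpos : 0 ≤ inner ℝ v u := by
    by_contra! hneg
    -- This `y` is so small that the quadratic term is at most half of the linear one; the `+ 1`
    -- avoids dividing by zero when `C * ‖u‖ = 0`.
    have := key (min 1 (-(inner ℝ v u) / (2 * (C * ‖u‖ + 1)))) ?_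
    · set z := min 1 (-(inner ℝ v u) / (2 * (C * ‖u‖ + 1)))
      have hK : 0 ≤ C * ‖u‖ := by positivity
      have hz : 0 < z := lt_min one_pos (div_pos (by linarith) (by positivity))
      have hz2 : z ≤ -(inner ℝ v u) / (2 * (C * ‖u‖ + 1)) := min_le_right _ _
      rw [le_div_iff₀ (by positivity)] at hz2
      rw [sq_abs] at this
      have h5 : 0 ≤ z * (inner ℝ v u + C * ‖u‖ * z) := by nlinarith
      have h6 := nonneg_of_mul_nonneg_right h5 hz
      nlinarith
    · rw [abs_of_nonneg]
      · exact min_le_left _ _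
      · exact le_min zero_le_one (div_nonneg (by linarith) (by positivity))
  have hneg : inner ℝ v u ≤ 0 := by
    by_contra! hp
    have := key (-min 1 ((inner ℝ v u) / (2 * (C * ‖u‖ + 1)))) ?_
    · set z := min 1 ((inner ℝ v u) / (2 * (C * ‖u‖ + 1)))
      have hK : 0 ≤ C * ‖u‖ := by positivity
      have hz : 0 < z := lt_min one_pos (div_pos (by linarith) (by positivity))
      have hz2 : z ≤ (inner ℝ v u) / (2 * (C * ‖u‖ + 1)) := min_le_right _ _
      rw [le_div_iff₀ (by positivity)] at hz2
      rw [sq_abs] at this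
      have h5 : 0 ≤ z * (-inner ℝ v u + C * ‖u‖ * z) := by nlinarith
      have h6 := nonneg_of_mul_nonneg_right h5 hz
      nlinarith
    · rw [abs_neg, abs_of_nonneg]
      · exact min_le_left _ _
      · exact le_min zero_le_one (div_nonneg hp.le (by positivity))
  exact le_antisymm hneg hpos

/-- `L f` is a limit in `L²(ℝ)` of generators of compound Poisson processes applied to `f`. -/
theorem exists_jump_approx {cp cm : ℝ} (hcp : 0 ≤ cp) (hcm : 0 ≤ cm) {α : ℝ} (h0 : 0 < α)
    (h2 : α < 2) (f : 𝓢(ℝ, ℝ)) {δ : ℝ} (hδ : 0 < δ) :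
    ∃ (s : Finset ℝ) (a : ℝ → ℝ), (∀ y, 0 ≤ a y) ∧
      ‖levyL2 cp cm h0 h2 f
        - ∑ y ∈ s, a y • (schwartzToL2 (shift y f) - schwartzToL2 f)‖ ≤ δ := by
  set S : PointedCone ℝ L2Line := PointedCone.hull ℝ (Set.range (jumpIncr 0 f)) with hS
  -- Otherwise some `u` is nonnegative on the cone and negative on `L f`. Such a `u` is orthogonal
  -- to `f'`, so the compensator disappears from the product of `L f` with `u`, leaving an integral
  -- of nonnegative terms: a contradiction.
  have hmem : levyL2 cp cm h0 h2 f ∈ closure (S : Set L2Line) := by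
    by_contra hnot
    obtain ⟨u, hu, hu0⟩ := ProperCone.hyperplane_separation' (E := L2Line)
      ⟨S.closure, isClosed_closure⟩ (x₀ := levyL2 cp cm h0 h2 f) hnot
    have hpos : ∀ y, 0 ≤ inner ℝ (jumpIncr 0 f y) u := fun y =>
      hu _ (subset_closure (Submodule.subset_span ⟨y, rfl⟩))
    have hd := inner_deriv_eq_zero f u hpos
    refine absurd hu0 (not_lt.2 ?_)
    rw [levyL2_eq_integral, real_inner_comm, ← integral_inner (integrable_smul_jumpIncr cp cm h0 h2 f)]
    refine integral_nonneg fun y => ?_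
    have hj : 0 ≤ jumpCoeff cp cm y / |y| ^ (1 + α) := by
      refine div_nonneg ?_ (by positivity)
      unfold jumpCoeff
      split_ifs <;> first | assumption | exact le_rfl
    have : jumpIncr (centering α y) f y = jumpIncr 0 f y
        - centering α y • schwartzToL2 (SchwartzMap.derivCLM ℝ ℝ f) := by simp [jumpIncr]
    simp only [Pi.zero_apply]
    rw [real_inner_smul_right, this, inner_sub_right, real_inner_smul_right, real_inner_comm,
      real_inner_comm _ u, hd]
    simpa using mul_nonneg hj (hpos y)
  obtain ⟨w, hw, hdist⟩ := Metric.mem_closure_iff.1 hmem δ hδ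
  obtain ⟨c, hc⟩ := (Finsupp.mem_span_range_iff_exists_finsupp).1 hw
  refine ⟨c.support, fun y => (c y : ℝ), fun y => (c y).2, ?_⟩
  rw [dist_eq_norm, ← hc, Finsupp.sum] at hdist
  have hsum : ∑ y ∈ c.support, c y • jumpIncr 0 f y
      = ∑ y ∈ c.support, (c y : ℝ) • (schwartzToL2 (shift y f) - schwartzToL2 f) :=
    Finset.sum_congr rfl fun y _ => by rw [jumpIncr, zero_smul, sub_zero]; rfl
  rw [hsum] at hdist
  exact hdist.le

/-! ### Approximate solutions of the backward equation -/

/-- The weights `e^{-λu} u^k / k!`. -/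
noncomputable def poissonWeight (lam : ℝ) (k : ℕ) (u : ℝ) : ℝ :=
  Real.exp (-lam * u) * (u ^ k / k.factorial)

/-- The derivative in `u` of the weights `e^{-λu} u^k / k!`. -/
noncomputable def poissonWeightDeriv (lam : ℝ) : ℕ → ℝ → ℝ
  | 0, u => -lam * poissonWeight lam 0 u
  | k + 1, u => poissonWeight lam k u - lam * poissonWeight lam (k + 1) u

/-- The recursion `w_k' = w_{k-1} - λ w_k`, with `w_{-1} = 0`, is what makes `sum_backward_eq`
telescope. -/
theorem hasDerivAt_poissonWeight (lam : ℝ) (k : ℕ) (u : ℝ) :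
    HasDerivAt (poissonWeight lam k) (poissonWeightDeriv lam k u) u := by
  have he : HasDerivAt (fun u => Real.exp (-lam * u)) (Real.exp (-lam * u) * -lam) u := by
    simpa using ((hasDerivAt_id u).const_mul (-lam)).exp
  have hp := (hasDerivAt_pow k u).div_const (k.factorial : ℝ)
  have h := he.mul hp
  refine h.congr_deriv ?_
  cases k with
  | zero => simp [poissonWeightDeriv, poissonWeight]; ring
  | succ k =>
    have hk : ((k.factorial : ℕ) : ℝ) ≠ 0 := by positivity
    simp only [poissonWeightDeriv, poissonWeight, Nat.factorial_succ, Nat.cast_mul,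
      add_tsub_cancel_right]
    field_simp
    push_cast
    ring

theorem continuous_poissonWeight (lam : ℝ) (k : ℕ) : Continuous (poissonWeight lam k) := by
  unfold poissonWeight
  fun_prop

theorem continuous_poissonWeightDeriv (lam : ℝ) (k : ℕ) :
    Continuous (poissonWeightDeriv lam k) := by
  have := continuous_poissonWeight lam
  cases k <;> unfold poissonWeightDeriv <;> fun_prop

theorem poissonWeight_nonneg (lam : ℝ) (k : ℕ) {u : ℝ} (hu : 0 ≤ u) :
    0 ≤ poissonWeight lam k u := by
  unfold poissonWeight
  positivity

/-- The terms are Poisson probabilities of mean `λu`. The powers `λ^k` are kept out of the weights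
because they come from the norm of the `k`-th iterate of the jump part. -/
theorem sum_poissonWeight_mul_le_one {lam u : ℝ} (hl : 0 ≤ lam) (hu : 0 ≤ u) (N : ℕ) :
    ∑ k ∈ Finset.range N, poissonWeight lam k u * lam ^ k ≤ 1 := by
  have h := Real.sum_le_exp_of_nonneg (mul_nonneg hl hu) N
  calc _ = Real.exp (-lam * u) * ∑ k ∈ Finset.range N, (lam * u) ^ k / k.factorial := by
        rw [Finset.mul_sum]
        refine Finset.sum_congr rfl fun k _ => ?_
        rw [poissonWeight, mul_pow]
        ring
    _ ≤ Real.exp (-lam * u) * Real.exp (lam * u) := by gcongr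
    _ = 1 := by rw [← Real.exp_add]; simp

/-- The jump part `f ↦ ∑ a(y) f(· + y)` of the generator of a compound Poisson process. -/
noncomputable def jumpSum (s : Finset ℝ) (a : ℝ → ℝ) : 𝓢(ℝ, ℝ) →L[ℝ] 𝓢(ℝ, ℝ) :=
  ∑ y ∈ s, a y • shift y

theorem jumpSum_apply (s : Finset ℝ) (a : ℝ → ℝ) (f : 𝓢(ℝ, ℝ)) :
    jumpSum s a f = ∑ y ∈ s, a y • shift y f := by
  simp [jumpSum]

theorem norm_sum_smul_shiftL2_le {s : Finset ℝ} {a : ℝ → ℝ} (ha : ∀ y, 0 ≤ a y) (u : L2Line) :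
    ‖∑ y ∈ s, a y • shiftL2 y u‖ ≤ (∑ y ∈ s, a y) * ‖u‖ := by
  rw [Finset.sum_mul]
  refine norm_sum_le_of_le _ fun y _ => ?_
  rw [norm_smul, LinearIsometry.norm_map, Real.norm_of_nonneg (ha y)]

theorem schwartzToL2_jumpSum (s : Finset ℝ) (a : ℝ → ℝ) (f : 𝓢(ℝ, ℝ)) :
    schwartzToL2 (jumpSum s a f) = ∑ y ∈ s, a y • shiftL2 y (schwartzToL2 f) := by
  simp_rw [jumpSum_apply, map_sum, map_smul, schwartzToL2_shift]

theorem levyL2_jumpSum (cp cm : ℝ) {α : ℝ} (h0 : 0 < α) (h2 : α < 2) (s : Finset ℝ)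
    (a : ℝ → ℝ) (f : 𝓢(ℝ, ℝ)) :
    levyL2 cp cm h0 h2 (jumpSum s a f) = ∑ y ∈ s, a y • shiftL2 y (levyL2 cp cm h0 h2 f) := by
  simp_rw [jumpSum_apply, map_sum, map_smul, levyL2_shift]

/-- The error made in replacing the generator by that of a compound Poisson process. -/
noncomputable def jumpError (cp cm : ℝ) {α : ℝ} (h0 : 0 < α) (h2 : α < 2) (s : Finset ℝ)
    (a : ℝ → ℝ) (f : 𝓢(ℝ, ℝ)) : L2Line :=
  levyL2 cp cm h0 h2 f - schwartzToL2 (jumpSum s a f) + (∑ y ∈ s, a y) • schwartzToL2 f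

/-- The error operator `L - J + λ` commutes with translations, hence with their combination `J`. -/
theorem jumpError_jumpSum (cp cm : ℝ) {α : ℝ} (h0 : 0 < α) (h2 : α < 2) (s : Finset ℝ)
    (a : ℝ → ℝ) (f : 𝓢(ℝ, ℝ)) :
    jumpError cp cm h0 h2 s a (jumpSum s a f)
      = ∑ y ∈ s, a y • shiftL2 y (jumpError cp cm h0 h2 s a f) := by
  simp only [jumpError, map_add, map_sub, map_smul, smul_add, smul_sub, Finset.sum_add_distrib,
    Finset.sum_sub_distrib]
  rw [levyL2_jumpSum, schwartzToL2_jumpSum s a (jumpSum s a f)]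
  congr 1
  simp_rw [smul_comm _ (∑ y ∈ s, a y)]
  rw [← Finset.smul_sum, schwartzToL2_jumpSum]

theorem norm_jumpSum_iterate_le {s : Finset ℝ} {a : ℝ → ℝ} (ha : ∀ y, 0 ≤ a y) (f : 𝓢(ℝ, ℝ))
    (k : ℕ) : ‖schwartzToL2 ((jumpSum s a)^[k] f)‖ ≤ (∑ y ∈ s, a y) ^ k * ‖schwartzToL2 f‖ := by
  have hl : 0 ≤ ∑ y ∈ s, a y := Finset.sum_nonneg fun y _ => ha y
  induction k with
  | zero => simp
  | succ k ih =>
    rw [Function.iterate_succ_apply', schwartzToL2_jumpSum]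
    refine (norm_sum_smul_shiftL2_le ha _).trans ?_
    calc _ ≤ (∑ y ∈ s, a y) * ((∑ y ∈ s, a y) ^ k * ‖schwartzToL2 f‖) := by gcongr
      _ = _ := by ring

/-- On `L²(ℝ)` a combination of translations with nonnegative weights has norm at most the total
weight. Thus smallness of the error at `f` alone controls it along all iterates. -/
theorem norm_jumpError_iterate_le (cp cm : ℝ) {α : ℝ} (h0 : 0 < α) (h2 : α < 2) {s : Finset ℝ}
    {a : ℝ → ℝ} (ha : ∀ y, 0 ≤ a y) (f : 𝓢(ℝ, ℝ)) (k : ℕ) :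
    ‖jumpError cp cm h0 h2 s a ((jumpSum s a)^[k] f)‖
      ≤ (∑ y ∈ s, a y) ^ k * ‖jumpError cp cm h0 h2 s a f‖ := by
  have hl : 0 ≤ ∑ y ∈ s, a y := Finset.sum_nonneg fun y _ => ha y
  induction k with
  | zero => simp
  | succ k ih =>
    rw [Function.iterate_succ_apply', jumpError_jumpSum]
    refine (norm_sum_smul_shiftL2_le ha _).trans ?_
    calc _ ≤ (∑ y ∈ s, a y) * ((∑ y ∈ s, a y) ^ k * ‖jumpError cp cm h0 h2 s a f‖) := by gcongr
      _ = _ := by ring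

/-- Put `L = error + J - λ`. The terms in `λ` cancel against those of the weight derivatives, and
`w_k J^{k+1} f - w_{k-1} J^k f` telescopes, leaving only the last term, due to truncation. The sign
in front of the derivative reflects `u = t - s`. -/
theorem sum_backward_eq (cp cm : ℝ) {α : ℝ} (h0 : 0 < α) (h2 : α < 2) (s : Finset ℝ)
    (a : ℝ → ℝ) (f : 𝓢(ℝ, ℝ)) (u : ℝ) (N : ℕ) :
    ∑ k ∈ Finset.range (N + 1),
      (-poissonWeightDeriv (∑ y ∈ s, a y) k u • schwartzToL2 ((jumpSum s a)^[k] f)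
        + poissonWeight (∑ y ∈ s, a y) k u • levyL2 cp cm h0 h2 ((jumpSum s a)^[k] f))
    = ∑ k ∈ Finset.range (N + 1),
        poissonWeight (∑ y ∈ s, a y) k u • jumpError cp cm h0 h2 s a ((jumpSum s a)^[k] f)
      + poissonWeight (∑ y ∈ s, a y) N u • schwartzToL2 ((jumpSum s a)^[N + 1] f) := by
  induction N with
  | zero =>
    simp only [zero_add, Finset.sum_range_one, Function.iterate_zero, id, poissonWeightDeriv,
      Function.iterate_one, jumpError]
    module
  | succ N ih =>
    rw [Finset.sum_range_succ, ih, Finset.sum_range_succ _ (N + 1)]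
    simp only [poissonWeightDeriv, jumpError, Function.iterate_succ_apply' _ (N + 1)]
    module

/-- For each Schwartz function `f` there is a trajectory `∑ φ_k(s) g_k` in the Schwartz space,
with value `f` at time `t`, which solves the equation `∂_s f_s + L f_s = 0` on `[0, t]` up to an
error of size `δ` in `L²(ℝ)`. -/
theorem exists_approx_backward {cp cm : ℝ} (hcp : 0 ≤ cp) (hcm : 0 ≤ cm) {α : ℝ} (h0 : 0 < α)
    (h2 : α < 2) (f : 𝓢(ℝ, ℝ)) {t : ℝ} (ht : 0 ≤ t) {δ : ℝ} (hδ : 0 < δ) :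
    ∃ (N : ℕ) (g : ℕ → 𝓢(ℝ, ℝ)) (φ φ' : ℕ → ℝ → ℝ),
      (∀ k s, HasDerivAt (φ k) (φ' k s) s) ∧ (∀ k, Continuous (φ' k)) ∧
      ∑ k ∈ Finset.range N, φ k t • g k = f ∧
      ∀ s ∈ Set.Icc 0 t, ‖∑ k ∈ Finset.range N,
        (φ' k s • schwartzToL2 (g k) + φ k s • levyL2 cp cm h0 h2 (g k))‖ ≤ δ := by
  obtain ⟨S, a, ha, herr⟩ := exists_jump_approx hcp hcm h0 h2 f (half_pos hδ)
  set lam := ∑ y ∈ S, a y with hlam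
  have hl : 0 ≤ lam := Finset.sum_nonneg fun y _ => ha y
  have hE : ‖jumpError cp cm h0 h2 S a f‖ ≤ δ / 2 := by
    convert herr using 2
    simp_rw [jumpError, smul_sub, Finset.sum_sub_distrib, ← Finset.sum_smul, ← hlam,
      schwartzToL2_jumpSum, schwartzToL2_shift]
    abel
  -- Half of `δ` pays for replacing `L` by the jump generator, the other half for truncation; this
  -- quantity bounds the truncation term uniformly in `s ∈ [0, t]`.
  have hlim : Tendsto (fun N : ℕ => (lam * t) ^ N / N.factorial * (lam * ‖schwartzToL2 f‖)) atTop
      (𝓝 0) := by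
    simpa using (FloorSemiring.tendsto_pow_div_factorial_atTop (lam * t)).mul_const
      (lam * ‖schwartzToL2 f‖)
  obtain ⟨N, hN⟩ := (hlim.eventually_le_const (half_pos hδ)).exists
  refine ⟨N + 1, fun k => (jumpSum S a)^[k] f, fun k s => poissonWeight lam k (t - s),
    fun k s => -poissonWeightDeriv lam k (t - s), fun k s => ?_, fun k => ?_, ?_, fun s hs => ?_⟩
  · have := (hasDerivAt_poissonWeight lam k (t - s)).scomp s ((hasDerivAt_id s).const_sub t)
    simpa [Function.comp_def] using this
  · have := continuous_poissonWeightDeriv lam k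
    fun_prop
  -- At `s = t` all weights vanish except the one with `k = 0`, which is 1.
  · rw [Finset.sum_range_succ', Finset.sum_eq_zero]
    · simp [poissonWeight]
    · intro k _
      simp [poissonWeight]
  · rw [sum_backward_eq]
    have hu : 0 ≤ t - s := by linarith [hs.2]
    refine (norm_add_le _ _).trans ?_
    have h1 : ‖∑ k ∈ Finset.range (N + 1),
        poissonWeight lam k (t - s) • jumpError cp cm h0 h2 S a ((jumpSum S a)^[k] f)‖ ≤ δ / 2 := by
      calc _ ≤ ∑ k ∈ Finset.range (N + 1), poissonWeight lam k (t - s) * lam ^ k * (δ / 2) := by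
            refine norm_sum_le_of_le _ fun k _ => ?_
            rw [norm_smul, Real.norm_of_nonneg (poissonWeight_nonneg _ _ hu), mul_assoc]
            refine mul_le_mul_of_nonneg_left ?_ (poissonWeight_nonneg _ _ hu)
            refine (norm_jumpError_iterate_le cp cm h0 h2 ha f k).trans ?_
            gcongr
        _ ≤ 1 * (δ / 2) := by
            rw [← Finset.sum_mul]
            gcongr
            exact sum_poissonWeight_mul_le_one hl hu _
        _ = δ / 2 := one_mul _
    have h3 : ‖poissonWeight lam N (t - s) • schwartzToL2 ((jumpSum S a)^[N + 1] f)‖ ≤ δ / 2 := by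
      refine le_trans ?_ hN
      rw [norm_smul, Real.norm_of_nonneg (poissonWeight_nonneg _ _ hu)]
      have hw : poissonWeight lam N (t - s) ≤ t ^ N / N.factorial := by
        unfold poissonWeight
        calc _ ≤ 1 * ((t - s) ^ N / N.factorial) := by
              gcongr
              rw [Real.exp_le_one_iff]
              nlinarith
          _ ≤ t ^ N / N.factorial := by
              rw [one_mul]
              gcongr
              linarith [hs.1]
      calc _ ≤ t ^ N / N.factorial * (lam ^ (N + 1) * ‖schwartzToL2 f‖) := by
            gcongr
            exact norm_jumpSum_iterate_le ha f (N + 1)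
        _ = _ := by rw [mul_pow, pow_succ]; ring
    linarith

/-! ### Test trajectories of finite rank -/

/-- The trajectory `s ↦ ∑ φ_k(s) g_k`. -/
noncomputable def finTraj (N : ℕ) (φ : ℕ → ℝ → ℝ) (g : ℕ → 𝓢(ℝ, ℝ)) (s : ℝ) : 𝓢(ℝ, ℝ) :=
  ∑ k ∈ Finset.range N, φ k s • g k

/-- With finite rank, convergence in the Schwartz topology reduces to that of scalar difference
quotients. -/
theorem isTestTrajectory_finTraj (T : ℝ) (N : ℕ) {φ φ' : ℕ → ℝ → ℝ} (g : ℕ → 𝓢(ℝ, ℝ))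
    (hφ : ∀ k s, HasDerivAt (φ k) (φ' k s) s) (hφ' : ∀ k, Continuous (φ' k)) :
    IsTestTrajectory T (fun s => finTraj N φ g s) (fun s => finTraj N φ' g s) := by
  refine ⟨?_, fun t => ?_⟩
  · unfold finTraj
    refine continuous_finsetSum _ fun k _ => ?_
    exact ((hφ' k).comp continuous_subtype_val).smul continuous_const
  · unfold finTraj
    simp_rw [← Finset.sum_sub_distrib, ← sub_smul, Finset.smul_sum, smul_smul]
    refine tendsto_finsetSum _ fun k _ => Tendsto.smul_const ?_ _
    have h := hasDerivAt_iff_tendsto_slope.1 (hφ k t)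
    have hv : Tendsto (Subtype.val : Set.Icc (0 : ℝ) T → ℝ) (𝓝[≠] t) (𝓝[≠] (t : ℝ)) := by
      refine tendsto_nhdsWithin_iff.2 ⟨(continuous_subtype_val.tendsto t).mono_left
        nhdsWithin_le_nhds, ?_⟩
      filter_upwards [self_mem_nhdsWithin] with s hs
      exact fun h => hs (Subtype.ext h)
    exact h.comp hv

theorem cutLevy_finTraj (cp cm : ℝ) {α ε : ℝ} (h0 : 0 < α) (h2 : α < 2) (hε : 0 < ε) (N : ℕ)
    (φ : ℕ → ℝ → ℝ) (g : ℕ → 𝓢(ℝ, ℝ)) (s : ℝ) :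
    cutLevy cp cm α ε (finTraj N φ g s) = finTraj N φ (fun k => cutLevy cp cm α ε (g k)) s := by
  unfold finTraj
  induction N with
  | zero =>
    ext x
    rw [cutLevy_apply cp cm h0 h2 hε]
    have := levyOp_smul cp cm α 0 0 x
    simp only [zero_smul, zero_mul] at this
    simpa using this
  | succ N ih =>
    rw [Finset.sum_range_succ, Finset.sum_range_succ, ← ih]
    ext x
    simp only [add_apply, smul_apply, smul_eq_mul]
    rw [cutLevy_apply cp cm h0 h2 hε, cutLevy_apply cp cm h0 h2 hε, cutLevy_apply cp cm h0 h2 hε,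
      levyOp_add cp cm h0 h2, levyOp_smul]
    ring

/-- Dominated convergence: the cutoff lies in `[0, 1]`, tends to 1, and `|L f|²` is integrable. This
lets `L²(ℝ)` bounds on `L f` control the drift, although `L f` need not be a test function. -/
theorem tendsto_cutLevy (cp cm : ℝ) {α : ℝ} (h0 : 0 < α) (h2 : α < 2) (f : 𝓢(ℝ, ℝ)) :
    Tendsto (fun ε => schwartzToL2 (cutLevy cp cm α ε f)) (𝓝[>] 0)
      (𝓝 (levyL2 cp cm h0 h2 f)) := by
  rw [tendsto_iff_norm_sub_tendsto_zero]
  have hL := memLp_levyOp cp cm h0 h2 f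
  have hsq : Integrable fun x => levyOp cp cm α f x ^ 2 := hL.integrable_sq
  have hnorm : ∀ ε > 0, ‖schwartzToL2 (cutLevy cp cm α ε f) - levyL2 cp cm h0 h2 f‖
      = √(∫ x, ((Real.exp (-(ε * x) ^ 2) - 1) * levyOp cp cm α f x) ^ 2) := by
    intro ε hε
    rw [@norm_eq_sqrt_real_inner, L2.inner_def]
    congr 1
    refine integral_congr_ae ?_
    filter_upwards [Lp.coeFn_sub (schwartzToL2 (cutLevy cp cm α ε f)) (levyL2 cp cm h0 h2 f),
      coeFn_schwartzToL2 (cutLevy cp cm α ε f), coeFn_levyL2 cp cm h0 h2 f] with x e1 e2 e3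
    rw [e1, Pi.sub_apply, e2, e3, cutLevy_apply cp cm h0 h2 hε]
    simp only [RCLike.inner_apply, conj_trivial]
    ring
  have hint : Tendsto (fun ε : ℝ =>
      ∫ x, ((Real.exp (-(ε * x) ^ 2) - 1) * levyOp cp cm α f x) ^ 2) (𝓝[>] 0) (𝓝 0) := by
    have h := tendsto_integral_filter_of_dominated_convergence (l := 𝓝[>] (0 : ℝ)) (μ := volume)
      (F := fun ε x => ((Real.exp (-(ε * x) ^ 2) - 1) * levyOp cp cm α f x) ^ 2)
      (f := fun _ => (0 : ℝ)) (fun x => levyOp cp cm α f x ^ 2) ?_ ?_ hsq ?_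
    · simpa using h
    · refine .of_forall fun ε => ?_
      refine AEStronglyMeasurable.pow ?_ 2
      exact (Continuous.aestronglyMeasurable (by fun_prop)).mul hL.aestronglyMeasurable
    · refine .of_forall fun ε => .of_forall fun x => ?_
      rw [Real.norm_of_nonneg (sq_nonneg _), mul_pow]
      have h1 : Real.exp (-(ε * x) ^ 2) ≤ 1 := by
        rw [Real.exp_le_one_iff]
        nlinarith [sq_nonneg (ε * x)]
      have h3 := Real.exp_pos (-(ε * x) ^ 2)
      have : (Real.exp (-(ε * x) ^ 2) - 1) ^ 2 ≤ 1 := by nlinarith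
      nlinarith [sq_nonneg (levyOp cp cm α f x)]
    · refine .of_forall fun x => ?_
      have hc : Continuous fun ε : ℝ =>
          ((Real.exp (-(ε * x) ^ 2) - 1) * levyOp cp cm α f x) ^ 2 := by fun_prop
      have := (hc.tendsto 0).mono_left (nhdsWithin_le_nhds (s := Set.Ioi 0))
      simpa using this
  have hs := (Real.continuous_sqrt.tendsto 0).comp hint
  rw [Real.sqrt_zero] at hs
  refine hs.congr' ?_
  filter_upwards [self_mem_nhdsWithin] with ε hε
  exact (hnorm ε hε).symm

/-! ### Martingales with deterministic quadratic variation -/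

section Levy

variable {Ω : Type*} {mΩ : MeasurableSpace Ω} {P : Measure Ω}

/-- Pull `Z` out of the conditional expectation. The target is general because `Z` is real in the
moment bounds and complex in the characteristic functions. -/
theorem integral_smul_eq_zero_of_condExp {E : Type*} [NormedAddCommGroup E] [NormedSpace ℝ E]
    [CompleteSpace E] [IsFiniteMeasure P] {m : MeasurableSpace Ω} (hm : m ≤ mΩ) {X : Ω → ℝ}
    {Z : Ω → E} (hX : Integrable X P) (hX0 : P[X | m] =ᵐ[P] 0) (hZ : StronglyMeasurable[m] Z)
    (hZX : Integrable (fun ω => X ω • Z ω) P) : ∫ ω, X ω • Z ω ∂P = 0 := by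
  rw [← integral_condExp hm]
  have h := condExp_bilin_of_aestronglyMeasurable_left (m := m) (μ := P)
    (ContinuousLinearMap.lsmul ℝ ℝ (E := E)).flip hZ.aestronglyMeasurable hZX hX
  rw [← integral_zero Ω E (μ := P)]
  refine integral_congr_ae ?_
  filter_upwards [h, hX0] with ω h1 h2
  exact h1.trans (by simp [h2])

theorem integrable_pow_mul_pow [IsFiniteMeasure P] {X Y : Ω → ℝ} (hX : MemLp X 4 P)
    (hY : MemLp Y 4 P) {i j : ℕ} (hij : i + j = 4) : Integrable (fun ω => X ω ^ i * Y ω ^ j) P := by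
  have h1 : Integrable (fun ω => ‖X ω‖ ^ 4) P := hX.integrable_norm_pow (p := 4) (by norm_num)
  have h2 : Integrable (fun ω => ‖Y ω‖ ^ 4) P := hY.integrable_norm_pow (p := 4) (by norm_num)
  refine (h1.add h2).mono' ((hX.aestronglyMeasurable.pow i).mul (hY.aestronglyMeasurable.pow j))
    (.of_forall fun ω => ?_)
  simp only [norm_mul, norm_pow, Pi.add_apply]
  have hx := norm_nonneg (X ω)
  have hy := norm_nonneg (Y ω)
  rcases le_total ‖X ω‖ ‖Y ω‖ with h | h
  · calc _ ≤ ‖Y ω‖ ^ i * ‖Y ω‖ ^ j := by gcongr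
      _ = ‖Y ω‖ ^ 4 := by rw [← pow_add, hij]
      _ ≤ _ := by linarith [pow_nonneg hx 4]
  · calc _ ≤ ‖X ω‖ ^ i * ‖X ω‖ ^ j := by gcongr
      _ = ‖X ω‖ ^ 4 := by rw [← pow_add, hij]
      _ ≤ _ := by linarith [pow_nonneg hy 4]

theorem integrable_pow_four [IsFiniteMeasure P] {X : Ω → ℝ} (hX : MemLp X 4 P) :
    Integrable (fun ω => X ω ^ 4) P := by
  simpa using integrable_pow_mul_pow hX hX (show 4 + 0 = 4 from rfl)

theorem memLp_two_sq [IsFiniteMeasure P] {X : Ω → ℝ} (hX : MemLp X 4 P) :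
    MemLp (fun ω => X ω ^ 2) 2 P := by
  refine (memLp_two_iff_integrable_sq (hX.aestronglyMeasurable.pow 2)).2 ?_
  simpa [← pow_mul] using integrable_pow_four hX

variable {ι : Type*} [Preorder ι] {ℱ : Filtration ι mΩ} {M : ι → Ω → ℝ} {A : ι → ℝ}

/-- `M` is a martingale with finite fourth moments, for which `M² - A` is a martingale. -/
structure IsL4Martingale (P : Measure Ω) (ℱ : Filtration ι mΩ) (M : ι → Ω → ℝ) (A : ι → ℝ) :
    Prop where
  martingale : Martingale M ℱ P
  martingale_sq : Martingale (fun t ω => M t ω ^ 2 - A t) ℱ P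
  memLp : ∀ t, MemLp (M t) 4 P

namespace IsL4Martingale

theorem memLp_incr (h : IsL4Martingale P ℱ M A) (s t : ι) : MemLp (fun ω => M t ω - M s ω) 4 P :=
  (h.memLp t).sub (h.memLp s)

theorem condExp_incr (h : IsL4Martingale P ℱ M A) {s t : ι} (hst : s ≤ t) :
    P[fun ω => M t ω - M s ω | ℱ s] =ᵐ[P] 0 := by
  have h1 := condExp_sub (h.martingale.integrable t) (h.martingale.integrable s) (ℱ s)
  have h2 := h.martingale.2 s t hst
  have h3 := h.martingale.2 s s le_rfl
  filter_upwards [h1, h2, h3] with ω e1 e2 e3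
  refine e1.trans ?_
  simp [e2, e3]

theorem integral_incr_smul [IsFiniteMeasure P] (h : IsL4Martingale P ℱ M A)
    {E : Type*} [NormedAddCommGroup E] [NormedSpace ℝ E]
    [CompleteSpace E] {s t : ι} (hst : s ≤ t) {Z : Ω → E} (hZ : StronglyMeasurable[ℱ s] Z)
    (hZX : Integrable (fun ω => (M t ω - M s ω) • Z ω) P) :
    ∫ ω, (M t ω - M s ω) • Z ω ∂P = 0 :=
  integral_smul_eq_zero_of_condExp (ℱ.le s)
    ((h.martingale.integrable t).sub (h.martingale.integrable s)) (h.condExp_incr hst) hZ hZX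

theorem integrable_sq_incr [IsFiniteMeasure P] (h : IsL4Martingale P ℱ M A)
    (s t : ι) : Integrable (fun ω => (M t ω - M s ω) ^ 2) P :=
  (memLp_two_sq (h.memLp_incr s t)).integrable (by norm_num)

theorem condExp_sq_incr [IsFiniteMeasure P] (h : IsL4Martingale P ℱ M A)
    {s t : ι} (hst : s ≤ t) :
    P[fun ω => (M t ω - M s ω) ^ 2 - (A t - A s) | ℱ s] =ᵐ[P] 0 := by
  have hm2 : ∀ t, MemLp (M t) 2 P := fun t => (h.memLp t).mono_exponent (by norm_num)
  have hmul : Integrable (fun ω => M s ω * (M t ω - M s ω)) P :=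
    (hm2 s).integrable_mul ((hm2 t).sub (hm2 s))
  have i1 : Integrable (fun ω => (M t ω ^ 2 - A t) - (M s ω ^ 2 - A s)) P :=
    (h.martingale_sq.integrable t).sub (h.martingale_sq.integrable s)
  -- The squared increment is the increment of `M²` minus `2 M_s (M_t - M_s)`, and the last term has
  -- zero conditional expectation.
  have e : (fun ω => (M t ω - M s ω) ^ 2 - (A t - A s))
      = (fun ω => (M t ω ^ 2 - A t) - (M s ω ^ 2 - A s))
        - (fun ω => (2 : ℝ) • (M s ω * (M t ω - M s ω))) := by
    ext ω
    simp only [Pi.sub_apply, smul_eq_mul]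
    ring
  have h1 := condExp_sub (h.martingale_sq.integrable t) (h.martingale_sq.integrable s) (ℱ s)
  have h2 := h.martingale_sq.2 s t hst
  have h3 := h.martingale_sq.2 s s le_rfl
  have h4 := condExp_mul_of_stronglyMeasurable_left (m := ℱ s) (μ := P) (f := M s)
    (g := fun ω => M t ω - M s ω) (h.martingale.1 s) hmul
    ((h.martingale.integrable t).sub (h.martingale.integrable s))
  have h5 := h.condExp_incr hst
  have h6 := condExp_sub i1 (hmul.smul (2 : ℝ)) (ℱ s)
  have h7 := condExp_smul (2 : ℝ) (fun ω => M s ω * (M t ω - M s ω)) (ℱ s) (μ := P)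
  rw [e]
  filter_upwards [h1, h2, h3, h4, h5, h6, h7] with ω e1 e2 e3 e4 e5 e6 e7
  refine e6.trans ?_
  have e1' : (P[fun ω => (M t ω ^ 2 - A t) - (M s ω ^ 2 - A s) | ℱ s]) ω = 0 := by
    refine e1.trans ?_
    simp [e2, e3]
  have e4' : (P[fun ω => M s ω * (M t ω - M s ω) | ℱ s]) ω = 0 := by
    refine e4.trans ?_
    simp [e5]
  have e7' : (P[fun ω => (2 : ℝ) • (M s ω * (M t ω - M s ω)) | ℱ s]) ω = 0 := by
    refine e7.trans ?_
    rw [Pi.smul_apply, e4', smul_zero]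
  rw [Pi.sub_apply, e1', zero_sub, Pi.zero_apply, neg_eq_zero]
  exact e7'

theorem integral_sq_incr_smul [IsFiniteMeasure P] (h : IsL4Martingale P ℱ M A)
    {E : Type*} [NormedAddCommGroup E] [NormedSpace ℝ E]
    [CompleteSpace E] {s t : ι} (hst : s ≤ t) {Z : Ω → E} (hZ : StronglyMeasurable[ℱ s] Z)
    (hZX : Integrable (fun ω => ((M t ω - M s ω) ^ 2 - (A t - A s)) • Z ω) P) :
    ∫ ω, ((M t ω - M s ω) ^ 2 - (A t - A s)) • Z ω ∂P = 0 :=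
  integral_smul_eq_zero_of_condExp (ℱ.le s)
    ((h.integrable_sq_incr s t).sub (integrable_const _)) (h.condExp_sq_incr hst) hZ hZX

/-- Write the increment as `x + y`, with `x` in the past of `y`, so that `x³y` has mean zero. Then
`(x + y)⁴ - x⁴ - 4x³y - y⁴/3 = (2/3) y² (3x + y)²`; `1/3` is the largest constant for which this
remains nonnegative. -/
theorem integral_pow_four_incr_le [IsFiniteMeasure P] (h : IsL4Martingale P ℱ M A)
    {s t u : ι} (hst : s ≤ t) (htu : t ≤ u) :
    ∫ ω, (M t ω - M s ω) ^ 4 ∂P + (1 / 3) * ∫ ω, (M u ω - M t ω) ^ 4 ∂P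
      ≤ ∫ ω, (M u ω - M s ω) ^ 4 ∂P := by
  have hN := h.memLp_incr s t
  have hD := h.memLp_incr t u
  have i1 := integrable_pow_four hN
  have i2 := integrable_pow_four hD
  have i3 := integrable_pow_mul_pow hD hN (show 1 + 3 = 4 from rfl)
  simp only [pow_one] at i3
  have z : ∫ ω, (M u ω - M t ω) * (M t ω - M s ω) ^ 3 ∂P = 0 := by
    refine h.integral_incr_smul htu (Z := fun ω => (M t ω - M s ω) ^ 3) ?_ i3
    exact ((h.martingale.1 t).sub ((h.martingale.1 s).mono (ℱ.mono hst))).pow 3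
  have hle : ∫ ω, ((M t ω - M s ω) ^ 4 + 4 * ((M u ω - M t ω) * (M t ω - M s ω) ^ 3)
      + (1 / 3) * (M u ω - M t ω) ^ 4) ∂P ≤ ∫ ω, (M u ω - M s ω) ^ 4 ∂P := by
    refine integral_mono ((i1.add (i3.const_mul 4)).add (i2.const_mul _))
      (integrable_pow_four (h.memLp_incr s u)) fun ω => ?_
    have e : M u ω - M s ω = (M t ω - M s ω) + (M u ω - M t ω) := by ring
    simp only [e]
    generalize M t ω - M s ω = x
    generalize M u ω - M t ω = y
    nlinarith [mul_nonneg (sq_nonneg y) (sq_nonneg (3 * x + y))]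
  have i13 : Integrable (fun ω => (M t ω - M s ω) ^ 4
      + 4 * ((M u ω - M t ω) * (M t ω - M s ω) ^ 3)) P := i1.add (i3.const_mul 4)
  rw [integral_add i13 (i2.const_mul _), integral_add i1 (i3.const_mul 4), integral_const_mul, integral_const_mul, z] at hle
  linarith

theorem integral_sq_incr [IsProbabilityMeasure P] (h : IsL4Martingale P ℱ M A)
    {s t : ι} (hst : s ≤ t) :
    ∫ ω, (M t ω - M s ω) ^ 2 ∂P = A t - A s := by
  have i := h.integrable_sq_incr s t
  have := h.integral_sq_incr_smul hst (Z := fun _ => (1 : ℝ)) stronglyMeasurable_const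
    (by simp only [smul_eq_mul, mul_one]; exact i.sub (integrable_const (A t - A s)))
  simp only [smul_eq_mul, mul_one] at this
  rw [integral_sub i (integrable_const _)] at this
  simp at this
  linarith

theorem le_of_le [IsProbabilityMeasure P] (h : IsL4Martingale P ℱ M A)
    {s t : ι} (hst : s ≤ t) : A s ≤ A t := by
  have := h.integral_sq_incr hst
  have h0 : 0 ≤ ∫ ω, (M t ω - M s ω) ^ 2 ∂P := integral_nonneg fun ω => sq_nonneg _
  linarith

theorem sum_integral_pow_four_le [IsFiniteMeasure P] (h : IsL4Martingale P ℱ M A)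
    {r : ℕ → ι} (hr : Monotone r) (n : ℕ) :
    ∑ j ∈ Finset.range n, ∫ ω, (M (r (j + 1)) ω - M (r j) ω) ^ 4 ∂P
      ≤ 3 * ∫ ω, (M (r n) ω - M (r 0) ω) ^ 4 ∂P := by
  induction n with
  | zero => simp
  | succ n ih =>
    rw [Finset.sum_range_succ]
    have := h.integral_pow_four_incr_le (hr (Nat.zero_le n)) (hr n.le_succ)
    simp only [Nat.succ_eq_add_one] at this
    linarith

theorem sqSum_succ {ι : Type*} {M : ι → Ω → ℝ} (r : ℕ → ι) (n : ℕ) (ω : Ω) :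
    ∑ j ∈ Finset.range (n + 1), (M (r (j + 1)) ω - M (r j) ω) ^ 2
      = ∑ j ∈ Finset.range n, (M (r (j + 1)) ω - M (r j) ω) ^ 2
        + (M (r (n + 1)) ω - M (r n) ω) ^ 2 := Finset.sum_range_succ _ _

theorem memLp_sqSum [IsFiniteMeasure P] (h : IsL4Martingale P ℱ M A)
    (r : ℕ → ι) (n : ℕ) :
    MemLp (fun ω => ∑ j ∈ Finset.range n, (M (r (j + 1)) ω - M (r j) ω) ^ 2) 2 P :=
  memLp_finsetSum _ fun _ _ => memLp_two_sq (h.memLp_incr _ _)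

theorem integral_sqSum [IsProbabilityMeasure P] (h : IsL4Martingale P ℱ M A)
    {r : ℕ → ι} (hr : Monotone r) (n : ℕ) :
    ∫ ω, ∑ j ∈ Finset.range n, (M (r (j + 1)) ω - M (r j) ω) ^ 2 ∂P = A (r n) - A (r 0) := by
  rw [integral_finsetSum _ fun _ _ => h.integrable_sq_incr _ _]
  simp_rw [h.integral_sq_incr (hr (Nat.le_succ _))]
  exact Finset.sum_range_sub (fun j => A (r j)) n

/-- Since the conditional mean of a squared increment is the deterministic increment of `A`, the
cross terms are explicit and complete the square of `A (r n) - A (r 0)`. With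
`sum_integral_pow_four_le` this bounds the second moment of the quadratic sums uniformly over
partitions. -/
theorem integral_sqSum_sq_le [IsProbabilityMeasure P] (h : IsL4Martingale P ℱ M A)
    {r : ℕ → ι} (hr : Monotone r) (n : ℕ) :
    ∫ ω, (∑ j ∈ Finset.range n, (M (r (j + 1)) ω - M (r j) ω) ^ 2) ^ 2 ∂P
      ≤ (A (r n) - A (r 0)) ^ 2 + ∑ j ∈ Finset.range n,
        ∫ ω, (M (r (j + 1)) ω - M (r j) ω) ^ 4 ∂P := by
  induction n with
  | zero => simp
  | succ n ih =>
    simp_rw [sqSum_succ r n]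
    rw [Finset.sum_range_succ]
    set Q : Ω → ℝ := fun ω => ∑ j ∈ Finset.range n, (M (r (j + 1)) ω - M (r j) ω) ^ 2 with hQ
    have hQ2 : MemLp Q 2 P := h.memLp_sqSum r n
    have hD := h.memLp_incr (r n) (r (n + 1))
    have iQ := hQ2.integrable_sq
    have iD := integrable_pow_four hD
    have iQD : Integrable (fun ω => (M (r (n + 1)) ω - M (r n) ω) ^ 2 * Q ω) P :=
      (memLp_two_sq hD).integrable_mul hQ2
    have iQ1 : Integrable Q P := hQ2.integrable (by norm_num)
    have hQm : StronglyMeasurable[ℱ (r n)] Q := by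
      refine Finset.stronglyMeasurable_fun_sum _ fun j hj => ?_
      have hj' : j + 1 ≤ n := Finset.mem_range.1 hj
      exact (((h.martingale.1 _).mono (ℱ.mono (hr hj'))).sub
        ((h.martingale.1 _).mono (ℱ.mono (hr ((Nat.le_succ j).trans hj'))))).pow 2
    have hz : ∫ ω, (M (r (n + 1)) ω - M (r n) ω) ^ 2 * Q ω ∂P
        = (A (r (n + 1)) - A (r n)) * (A (r n) - A (r 0)) := by
      have hs := h.integral_sq_incr_smul (hr n.le_succ) hQm (by
        simp only [smul_eq_mul, sub_mul _ (A _ - A _)]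
        exact iQD.sub (iQ1.const_mul _))
      simp only [smul_eq_mul, sub_mul _ (A _ - A _), Nat.succ_eq_add_one] at hs
      rw [integral_sub iQD (iQ1.const_mul _), integral_const_mul, h.integral_sqSum hr n] at hs
      linarith
    have he : ∀ ω, (Q ω + (M (r (n + 1)) ω - M (r n) ω) ^ 2) ^ 2
        = Q ω ^ 2 + 2 * ((M (r (n + 1)) ω - M (r n) ω) ^ 2 * Q ω)
          + (M (r (n + 1)) ω - M (r n) ω) ^ 4 := fun ω => by ring
    have iQQ : Integrable (fun ω => Q ω ^ 2
        + 2 * ((M (r (n + 1)) ω - M (r n) ω) ^ 2 * Q ω)) P := iQ.add (iQD.const_mul 2)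
    rw [integral_congr_ae (.of_forall he), integral_add iQQ iD, integral_add iQ (iQD.const_mul 2),
      integral_const_mul, hz]
    nlinarith [sq_nonneg (A (r (n + 1)) - A (r n))]

end IsL4Martingale

/-- Cubic bound near 0, quadratic bound away from it. The factor `min 1 |x|` is later replaced by
the largest truncated increment of the partition. -/
theorem norm_exp_mul_I_sub_taylor_le (x : ℝ) :
    ‖Complex.exp (x * Complex.I) - 1 - x * Complex.I + (x : ℂ) ^ 2 / 2‖
      ≤ 4 * (min 1 |x| * x ^ 2) := by
  rcases le_or_gt |x| 1 with hx | hx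
  · rw [min_eq_right hx]
    have h := Complex.exp_bound (x := x * Complex.I) (by simpa using hx) (n := 3) (by norm_num)
    have e : Complex.exp (x * Complex.I) - 1 - x * Complex.I + (x : ℂ) ^ 2 / 2
        = Complex.exp (x * Complex.I) - ∑ m ∈ Finset.range 3, (x * Complex.I) ^ m / m.factorial := by
      simp only [Finset.sum_range_succ, Finset.sum_range_zero, Nat.factorial, mul_pow,
        Complex.I_sq]
      push_cast
      ring
    rw [e]
    refine h.trans ?_
    simp only [norm_mul, Complex.norm_real, Complex.norm_I, mul_one, Real.norm_eq_abs,
      Nat.factorial]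
    have h3 : |x| ^ 3 = |x| * x ^ 2 := by rw [pow_succ', sq_abs]
    rw [h3]
    have : 0 ≤ |x| * x ^ 2 := by positivity
    norm_num
    linarith
  · rw [min_eq_left hx.le]
    have h1 : ‖Complex.exp (x * Complex.I)‖ = 1 := Complex.norm_exp_ofReal_mul_I x
    calc _ ≤ ‖Complex.exp (x * Complex.I)‖ + ‖(1 : ℂ)‖ + ‖(x : ℂ) * Complex.I‖
            + ‖(x : ℂ) ^ 2 / 2‖ := by
          refine (norm_add_le _ _).trans ?_
          gcongr
          refine (norm_sub_le _ _).trans ?_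
          gcongr
          exact norm_sub_le _ _
      _ = 2 + |x| + x ^ 2 / 2 := by
          rw [h1]
          simp
          norm_num
      _ ≤ _ := by
          have : x ^ 2 = |x| ^ 2 := (sq_abs x).symm
          rw [this]
          nlinarith

namespace IsL4Martingale

theorem integrable_min_mul_sq [IsProbabilityMeasure P] (h : IsL4Martingale P ℱ M A)
    (s t : ι) :
    Integrable (fun ω => min 1 |M t ω - M s ω| * (M t ω - M s ω) ^ 2) P := by
  have hm := (h.memLp_incr s t).aestronglyMeasurable
  refine (h.integrable_sq_incr s t).mono'
    ((aestronglyMeasurable_const.inf hm.norm).mul (hm.pow 2)) (.of_forall fun ω => ?_)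
  have h0 : 0 ≤ min 1 |M t ω - M s ω| := le_min zero_le_one (abs_nonneg _)
  rw [norm_mul, Real.norm_of_nonneg h0, Real.norm_of_nonneg (sq_nonneg _)]
  exact mul_le_of_le_one_left (sq_nonneg _) (min_le_left _ _)

/-- The first order term of the exponential has zero mean against `Z`, the second order one gives
the increment of `A`; only the Taylor remainder is left. -/
theorem norm_integral_mul_exp_incr_sub_le [IsProbabilityMeasure P] (h : IsL4Martingale P ℱ M A)
    {s t : ι} (hst : s ≤ t) {Z : Ω → ℂ}
    (hZ : StronglyMeasurable[ℱ s] Z) (hZ1 : ∀ ω, ‖Z ω‖ ≤ 1) :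
    ‖∫ ω, Z ω * Complex.exp ((M t ω - M s ω : ℝ) * Complex.I) ∂P
        - (1 - (A t - A s) / 2) * ∫ ω, Z ω ∂P‖
      ≤ 4 * ∫ ω, min 1 |M t ω - M s ω| * (M t ω - M s ω) ^ 2 ∂P := by
  set D : Ω → ℝ := fun ω => M t ω - M s ω with hD
  have hZm : AEStronglyMeasurable Z P := (hZ.mono (ℱ.le s)).aestronglyMeasurable
  have hDm : AEStronglyMeasurable D P := (h.memLp_incr s t).aestronglyMeasurable
  have iZ : Integrable Z P := Integrable.of_bound hZm 1 (.of_forall hZ1)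
  have i1 : Integrable (fun ω => D ω • Z ω) P :=
    (((h.martingale.integrable t).sub (h.martingale.integrable s)).smul_bdd 1 hZm
      (.of_forall hZ1))
  have i2 : Integrable (fun ω => (D ω ^ 2 - (A t - A s)) • Z ω) P :=
    ((h.integrable_sq_incr s t).sub (integrable_const _)).smul_bdd 1 hZm (.of_forall hZ1)
  have z1 := h.integral_incr_smul hst hZ i1
  have z2 := h.integral_sq_incr_smul hst hZ i2
  have hexp : AEStronglyMeasurable (fun ω => Complex.exp ((D ω : ℝ) * Complex.I)) P :=
    (by fun_prop : Continuous fun x : ℝ => Complex.exp (x * Complex.I)).comp_aestronglyMeasurable hDm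
  have i3 : Integrable (fun ω => Z ω * Complex.exp ((D ω : ℝ) * Complex.I)) P := by
    refine Integrable.of_bound (hZm.mul hexp) 1 (.of_forall fun ω => ?_)
    rw [norm_mul, Complex.norm_exp_ofReal_mul_I, mul_one]
    exact hZ1 ω
  have key : ∫ ω, Z ω * Complex.exp ((D ω : ℝ) * Complex.I) ∂P
        - (1 - (A t - A s) / 2) * ∫ ω, Z ω ∂P
      = ∫ ω, Z ω * (Complex.exp (D ω * Complex.I) - 1 - D ω * Complex.I + (D ω : ℂ) ^ 2 / 2) ∂P := by
    have e : ∀ ω, Z ω * (Complex.exp (D ω * Complex.I) - 1 - D ω * Complex.I + (D ω : ℂ) ^ 2 / 2)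
        = Z ω * Complex.exp ((D ω : ℝ) * Complex.I) - (1 - (A t - A s) / 2) * Z ω
          - (Complex.I * (D ω • Z ω) - (1 / 2) * ((D ω ^ 2 - (A t - A s)) • Z ω)) := by
      intro ω
      simp only [Complex.real_smul]
      push_cast
      ring
    have i4 : Integrable (fun ω => Z ω * Complex.exp ((D ω : ℝ) * Complex.I)
        - (1 - (A t - A s) / 2) * Z ω) P := i3.sub (iZ.const_mul _)
    have i5 : Integrable (fun ω => Complex.I * (D ω • Z ω)
        - (1 / 2) * ((D ω ^ 2 - (A t - A s)) • Z ω)) P := (i1.const_mul _).sub (i2.const_mul _)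
    simp_rw [e]
    rw [integral_sub i4 i5,
      integral_sub i3 (iZ.const_mul _), integral_sub (i1.const_mul _) (i2.const_mul _),
      integral_const_mul, integral_const_mul, integral_const_mul, z1, z2]
    simp
  rw [key, ← integral_const_mul]
  refine norm_integral_le_of_norm_le ((h.integrable_min_mul_sq s t).const_mul 4)
    (.of_forall fun ω => ?_)
  rw [norm_mul]
  calc _ ≤ 1 * _ := mul_le_mul_of_nonneg_right (hZ1 ω) (norm_nonneg _)
    _ ≤ _ := by rw [one_mul]; exact norm_exp_mul_I_sub_taylor_le (D ω)

/-- A crude bound, but valid for increments of `A` of any size, so no continuity of `A` is needed.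
-/
theorem abs_one_sub_le_exp [IsProbabilityMeasure P] (h : IsL4Martingale P ℱ M A)
    {s t : ι} (hst : s ≤ t) :
    ‖(1 - (A t - A s) / 2 : ℂ)‖ ≤ Real.exp ((A t - A s) / 2) := by
  have ha : 0 ≤ A t - A s := by linarith [h.le_of_le hst]
  have e : (1 - (A t - A s) / 2 : ℂ) = ((1 - (A t - A s) / 2 : ℝ) : ℂ) := by push_cast; ring
  rw [e, Complex.norm_real, Real.norm_eq_abs]
  have := Real.add_one_le_exp ((A t - A s) / 2)
  rw [abs_le]
  constructor <;> linarith

/-- Iterates the one-step estimate: `Z` times the exponential of the increments so far is again a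
past variable bounded by 1. Each step multiplies the earlier error by a factor controlled by
`abs_one_sub_le_exp`. -/
theorem norm_integral_mul_exp_sub_prod_le [IsProbabilityMeasure P] (h : IsL4Martingale P ℱ M A)
    {r : ℕ → ι} (hr : Monotone r) {Z : Ω → ℂ}
    (hZ : StronglyMeasurable[ℱ (r 0)] Z) (hZ1 : ∀ ω, ‖Z ω‖ ≤ 1) (n : ℕ) :
    ‖∫ ω, Z ω * Complex.exp ((M (r n) ω - M (r 0) ω : ℝ) * Complex.I) ∂P
        - (∏ j ∈ Finset.range n, (1 - (A (r (j + 1)) - A (r j)) / 2 : ℂ)) * ∫ ω, Z ω ∂P‖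
      ≤ Real.exp ((A (r n) - A (r 0)) / 2) * (4 * ∑ j ∈ Finset.range n,
        ∫ ω, min 1 |M (r (j + 1)) ω - M (r j) ω| * (M (r (j + 1)) ω - M (r j) ω) ^ 2 ∂P) := by
  induction n with
  | zero => simp
  | succ n ih =>
    set c : ℂ := 1 - (A (r (n + 1)) - A (r n)) / 2 with hc
    set p := ∏ j ∈ Finset.range n, (1 - (A (r (j + 1)) - A (r j)) / 2 : ℂ) with hp
    set W : Ω → ℂ := fun ω => Z ω * Complex.exp ((M (r n) ω - M (r 0) ω : ℝ) * Complex.I) with hW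
    have hWm : StronglyMeasurable[ℱ (r n)] W := by
      refine (hZ.mono (ℱ.mono (hr n.zero_le))).mul ?_
      refine (by fun_prop : Continuous fun x : ℝ =>
        Complex.exp (x * Complex.I)).comp_stronglyMeasurable ?_
      exact (h.martingale.1 _).sub ((h.martingale.1 _).mono (ℱ.mono (hr n.zero_le)))
    have hW1 : ∀ ω, ‖W ω‖ ≤ 1 := fun ω => by
      rw [hW]
      simp only
      rw [norm_mul, Complex.norm_exp_ofReal_mul_I, mul_one]
      exact hZ1 ω
    have hstep := h.norm_integral_mul_exp_incr_sub_le (hr n.le_succ) hWm hW1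
    have e : ∀ ω, W ω * Complex.exp ((M (r (n + 1)) ω - M (r n) ω : ℝ) * Complex.I)
        = Z ω * Complex.exp ((M (r (n + 1)) ω - M (r 0) ω : ℝ) * Complex.I) := by
      intro ω
      rw [hW]
      simp only
      rw [mul_assoc, ← Complex.exp_add]
      congr 2
      push_cast
      ring
    simp only [Nat.succ_eq_add_one] at hstep
    simp_rw [e] at hstep
    rw [← hc] at hstep
    rw [Finset.prod_range_succ, Finset.sum_range_succ, ← hc, ← hp]
    have hce := h.abs_one_sub_le_exp (hr n.le_succ)
    simp only [Nat.succ_eq_add_one] at hce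
    rw [← hc] at hce
    have ha0 : A (r 0) ≤ A (r (n + 1)) := h.le_of_le (hr (Nat.zero_le _))
    set S := ∑ j ∈ Finset.range n,
        ∫ ω, min 1 |M (r (j + 1)) ω - M (r j) ω| * (M (r (j + 1)) ω - M (r j) ω) ^ 2 ∂P with hS
    set E := ∫ ω, min 1 |M (r (n + 1)) ω - M (r n) ω| * (M (r (n + 1)) ω - M (r n) ω) ^ 2 ∂P
    have hE : 0 ≤ E := integral_nonneg fun ω => mul_nonneg (le_min zero_le_one (abs_nonneg _))
      (sq_nonneg _)
    have split : ∫ ω, Z ω * Complex.exp ((M (r (n + 1)) ω - M (r 0) ω : ℝ) * Complex.I) ∂P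
        - p * c * ∫ ω, Z ω ∂P
        = (∫ ω, Z ω * Complex.exp ((M (r (n + 1)) ω - M (r 0) ω : ℝ) * Complex.I) ∂P
            - c * ∫ ω, W ω ∂P) + c * (∫ ω, W ω ∂P - p * ∫ ω, Z ω ∂P) := by ring
    rw [split]
    refine (norm_add_le _ _).trans ?_
    rw [norm_mul]
    have hmul : ‖c‖ * ‖∫ ω, W ω ∂P - p * ∫ ω, Z ω ∂P‖
        ≤ Real.exp ((A (r (n + 1)) - A (r n)) / 2)
          * (Real.exp ((A (r n) - A (r 0)) / 2) * (4 * S)) := by gcongr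
    rw [← mul_assoc, ← Real.exp_add, show (A (r (n + 1)) - A (r n)) / 2 + (A (r n) - A (r 0)) / 2
      = (A (r (n + 1)) - A (r 0)) / 2 by ring] at hmul
    have hone : 1 ≤ Real.exp ((A (r (n + 1)) - A (r 0)) / 2) :=
      Real.one_le_exp (by linarith)
    nlinarith

/-- The sum is at most the mean of `κ Q`, where `Q` is the quadratic sum. Young's inequality gives
`κ Q ≤ κ² / (4η) + η Q²`, and `κ² ≤ κ`. -/
theorem sum_integral_min_mul_sq_le [IsProbabilityMeasure P] (h : IsL4Martingale P ℱ M A)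
    {r : ℕ → ι} (hr : Monotone r) (n : ℕ) {κ : Ω → ℝ}
    (hκ : AEStronglyMeasurable κ P) (hκ1 : ∀ ω, κ ω ∈ Set.Icc (0 : ℝ) 1)
    (hκr : ∀ ω, ∀ j < n, min 1 |M (r (j + 1)) ω - M (r j) ω| ≤ κ ω) {η : ℝ} (hη : 0 < η) :
    ∑ j ∈ Finset.range n,
      ∫ ω, min 1 |M (r (j + 1)) ω - M (r j) ω| * (M (r (j + 1)) ω - M (r j) ω) ^ 2 ∂P
    ≤ (4 * η)⁻¹ * ∫ ω, κ ω ∂P + η * ((A (r n) - A (r 0)) ^ 2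
        + 3 * ∫ ω, (M (r n) ω - M (r 0) ω) ^ 4 ∂P) := by
  have hQ := h.memLp_sqSum r n
  have iκ : Integrable κ P := Integrable.of_bound hκ 1 (.of_forall fun ω => by
    rw [Real.norm_of_nonneg (hκ1 ω).1]; exact (hκ1 ω).2)
  rw [← integral_finsetSum _ fun j _ => h.integrable_min_mul_sq _ _]
  calc _ ≤ ∫ ω, ((4 * η)⁻¹ * κ ω
        + η * (∑ j ∈ Finset.range n, (M (r (j + 1)) ω - M (r j) ω) ^ 2) ^ 2) ∂P := by
        refine integral_mono (integrable_finsetSum _ fun j _ => h.integrable_min_mul_sq _ _)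
          ((iκ.const_mul _).add (hQ.integrable_sq.const_mul _)) fun ω => ?_
        simp only
        set Q := ∑ j ∈ Finset.range n, (M (r (j + 1)) ω - M (r j) ω) ^ 2
        have h1 : ∑ j ∈ Finset.range n,
            min 1 |M (r (j + 1)) ω - M (r j) ω| * (M (r (j + 1)) ω - M (r j) ω) ^ 2
            ≤ κ ω * Q := by
          rw [Finset.mul_sum]
          refine Finset.sum_le_sum fun j hj => ?_
          exact mul_le_mul_of_nonneg_right (hκr ω j (Finset.mem_range.1 hj)) (sq_nonneg _)
        refine h1.trans ?_
        have h2 : κ ω * Q ≤ (4 * η)⁻¹ * κ ω ^ 2 + η * Q ^ 2 := by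
          have e : (4 * η)⁻¹ * κ ω ^ 2 + η * Q ^ 2 - κ ω * Q
              = (4 * η)⁻¹ * (κ ω - 2 * η * Q) ^ 2 := by field_simp; ring
          have : 0 ≤ (4 * η)⁻¹ * (κ ω - 2 * η * Q) ^ 2 := by positivity
          linarith
        have h3 : κ ω ^ 2 ≤ κ ω := by nlinarith [(hκ1 ω).1, (hκ1 ω).2]
        have h4 : (4 * η)⁻¹ * κ ω ^ 2 ≤ (4 * η)⁻¹ * κ ω := by gcongr
        linarith
    _ = (4 * η)⁻¹ * ∫ ω, κ ω ∂P
        + η * ∫ ω, (∑ j ∈ Finset.range n, (M (r (j + 1)) ω - M (r j) ω) ^ 2) ^ 2 ∂P := by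
        rw [integral_add (iκ.const_mul _) (hQ.integrable_sq.const_mul _), integral_const_mul,
          integral_const_mul]
    _ ≤ _ := by
        gcongr
        exact (h.integral_sqSum_sq_le hr n).trans (by linarith [h.sum_integral_pow_four_le hr n])

end IsL4Martingale

end Levy

/-! ### Characteristic functions of continuous martingales -/

section Partition

variable {T : ℝ}

/-- The points of the partition of `[s, t]` in `n` intervals of the same length. -/
noncomputable def partitionPt (s t : Set.Icc (0 : ℝ) T) (n j : ℕ) : Set.Icc (0 : ℝ) T :=
  Set.projIcc 0 T (s.2.1.trans s.2.2) (s + (t - s) * (j / n))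

theorem partitionPt_zero (s t : Set.Icc (0 : ℝ) T) (n : ℕ) : partitionPt s t n 0 = s := by
  simp [partitionPt]

theorem partitionPt_self (s t : Set.Icc (0 : ℝ) T) {n : ℕ} (hn : n ≠ 0) :
    partitionPt s t n n = t := by
  simp [partitionPt, hn]

theorem monotone_partitionPt {s t : Set.Icc (0 : ℝ) T} (hst : s ≤ t) (n : ℕ) :
    Monotone (partitionPt s t n) := by
  intro i j hij
  refine Set.monotone_projIcc _ ?_
  have h : (s : ℝ) ≤ t := hst
  have h' : (i : ℝ) ≤ j := by exact_mod_cast hij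
  have : 0 ≤ (t : ℝ) - s := by linarith
  gcongr

theorem dist_partitionPt_le {s t : Set.Icc (0 : ℝ) T} (hst : s ≤ t) (n j : ℕ) :
    dist (partitionPt s t n (j + 1)) (partitionPt s t n j) ≤ (t - s) / n := by
  have h : (s : ℝ) ≤ t := hst
  have h1 := (LipschitzWith.projIcc (s.2.1.trans s.2.2)).dist_le_mul
    (s + (t - s) * ((j + 1 : ℕ) / n) : ℝ) (s + (t - s) * (j / n) : ℝ)
  refine h1.trans (le_of_eq ?_)
  rw [NNReal.coe_one, one_mul, Real.dist_eq]
  have e : (s + (t - s) * ((j + 1 : ℕ) / n) - (s + (t - s) * (j / n)) : ℝ) = (t - s) / n := by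
    push_cast
    ring
  rw [e, abs_of_nonneg (div_nonneg (by linarith) n.cast_nonneg)]

end Partition

theorem measurable_range_sup {Ω : Type*} [MeasurableSpace Ω] {f : ℕ → Ω → ℝ≥0}
    (hf : ∀ j, Measurable (f j)) (n : ℕ) :
    Measurable fun ω => (Finset.range n).sup fun j => f j ω := by
  induction n with
  | zero => simp
  | succ n ih =>
    simp_rw [Finset.range_add_one, Finset.sup_insert]
    exact (hf n).sup ih

section CharFun

variable {Ω : Type*} {mΩ : MeasurableSpace Ω} {P : Measure Ω} [IsProbabilityMeasure P] {T : ℝ}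
  {ℱ : Filtration (Set.Icc (0 : ℝ) T) mΩ} {M : Set.Icc (0 : ℝ) T → Ω → ℝ}
  {A : Set.Icc (0 : ℝ) T → ℝ}

/-- The largest increment of `M` over the partition, truncated at level one. -/
noncomputable def maxIncr (M : Set.Icc (0 : ℝ) T → Ω → ℝ) (s t : Set.Icc (0 : ℝ) T) (n : ℕ)
    (ω : Ω) : ℝ :=
  min 1 (((Finset.range n).sup fun j =>
    ‖M (partitionPt s t n (j + 1)) ω - M (partitionPt s t n j) ω‖₊ : ℝ≥0) : ℝ)

/-- Uniform continuity on the compact `[0, T]`; this is where continuity of the paths enters. -/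
theorem tendsto_maxIncr {ω : Ω} (hω : Continuous fun t => M t ω) {s t : Set.Icc (0 : ℝ) T}
    (hst : s ≤ t) : Tendsto (fun n => maxIncr M s t n ω) atTop (𝓝 0) := by
  have huc := CompactSpace.uniformContinuous_of_continuous hω
  rw [Metric.tendsto_atTop]
  intro ε hε
  obtain ⟨δ, hδ, H⟩ := Metric.uniformContinuous_iff.1 huc (ε / 2) (half_pos hε)
  have hlim : Tendsto (fun n : ℕ => ((t : ℝ) - s) / n) atTop (𝓝 0) :=
    tendsto_const_div_atTop_nhds_zero_nat _
  obtain ⟨N, hN⟩ := eventually_atTop.1 (hlim.eventually_lt_const hδ)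
  refine ⟨N, fun n hn => ?_⟩
  have h0 : 0 ≤ maxIncr M s t n ω := le_min zero_le_one (NNReal.coe_nonneg _)
  rw [Real.dist_eq, sub_zero, abs_of_nonneg h0]
  refine lt_of_le_of_lt (min_le_right _ _) (lt_of_le_of_lt ?_ (half_lt_self hε))
  rw [← Real.coe_toNNReal (ε / 2) (half_pos hε).le, NNReal.coe_le_coe, Finset.sup_le_iff]
  intro j _
  rw [← NNReal.coe_le_coe, coe_nnnorm, Real.coe_toNNReal _ (half_pos hε).le, ← dist_eq_norm]
  exact (H ((dist_partitionPt_le hst n j).trans_lt (hN n hn))).le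

theorem IsL4Martingale.tendsto_integral_mul_exp (h : IsL4Martingale P ℱ M A)
    (hcont : ∀ᵐ ω ∂P, Continuous fun t => M t ω) {s t : Set.Icc (0 : ℝ) T} (hst : s ≤ t)
    {Z : Ω → ℂ} (hZ : StronglyMeasurable[ℱ s] Z) (hZ1 : ∀ ω, ‖Z ω‖ ≤ 1) :
    Tendsto (fun n : ℕ => ∫ ω, Z ω * Complex.exp ((M t ω - M s ω : ℝ) * Complex.I) ∂P
      - (∏ j ∈ Finset.range n,
        (1 - (A (partitionPt s t n (j + 1)) - A (partitionPt s t n j)) / 2 : ℂ)) * ∫ ω, Z ω ∂P)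
      atTop (𝓝 0) := by
  set C := (A t - A s) ^ 2 + 3 * ∫ ω, (M t ω - M s ω) ^ 4 ∂P with hC
  have hC0 : 0 ≤ C := by
    have : 0 ≤ ∫ ω, (M t ω - M s ω) ^ 4 ∂P := integral_nonneg fun ω => by positivity
    positivity
  set K := Real.exp ((A t - A s) / 2) * 4 with hK
  have hK0 : 0 < K := by positivity
  have hMm : ∀ t, Measurable (M t) := fun t =>
    ((h.martingale.1 t).mono (ℱ.le t)).measurable
  have hκm : ∀ n, Measurable (maxIncr M s t n) := fun n =>
    measurable_const.min (measurable_range_sup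
      (fun j => ((hMm _).sub (hMm _)).nnnorm) n).coe_nnreal_real
  have hκ1 : ∀ n ω, maxIncr M s t n ω ∈ Set.Icc (0 : ℝ) 1 := fun n ω =>
    ⟨le_min zero_le_one (NNReal.coe_nonneg _), min_le_left _ _⟩
  have hκlim : Tendsto (fun n => ∫ ω, maxIncr M s t n ω ∂P) atTop (𝓝 0) := by
    have := tendsto_integral_of_dominated_convergence (μ := P) (F := maxIncr M s t)
      (f := fun _ => 0) (fun _ => 1) (fun n => (hκm n).aestronglyMeasurable)
      (integrable_const _) (fun n => .of_forall fun ω => by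
        rw [Real.norm_of_nonneg (hκ1 n ω).1]; exact (hκ1 n ω).2)
      (by filter_upwards [hcont] with ω hω using tendsto_maxIncr hω hst)
    simpa using this
  have hbound : ∀ η > 0, ∀ n ≠ 0,
      ‖∫ ω, Z ω * Complex.exp ((M t ω - M s ω : ℝ) * Complex.I) ∂P
        - (∏ j ∈ Finset.range n,
          (1 - (A (partitionPt s t n (j + 1)) - A (partitionPt s t n j)) / 2 : ℂ)) * ∫ ω, Z ω ∂P‖
      ≤ K * ((4 * η)⁻¹ * ∫ ω, maxIncr M s t n ω ∂P + η * C) := by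
    intro η hη n hn
    have hr := monotone_partitionPt hst n
    have h1 := h.norm_integral_mul_exp_sub_prod_le hr
      (Z := Z) (by rwa [partitionPt_zero]) hZ1 n
    have h2 := h.sum_integral_min_mul_sq_le hr n (hκm n).aestronglyMeasurable (hκ1 n)
      (fun ω j hj => by
        refine min_le_min_left _ ?_
        rw [← Real.norm_eq_abs, ← coe_nnnorm, NNReal.coe_le_coe]
        exact Finset.le_sup (f := fun j =>
          ‖M (partitionPt s t n (j + 1)) ω - M (partitionPt s t n j) ω‖₊) (Finset.mem_range.2 hj))
      hη
    rw [partitionPt_zero, partitionPt_self s t hn] at h1 h2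
    refine h1.trans ?_
    rw [hK, mul_assoc]
    gcongr
  rw [Metric.tendsto_atTop]
  intro ε hε
  -- First fix `η` to make the bounded second moment cost at most `ε / 4`, then refine the
  -- partition; the `+ 1` covers `C = 0`.
  set η := ε / (4 * (K * (C + 1))) with hη
  have hη0 : 0 < η := by positivity
  have h1 : K * (η * C) ≤ ε / 4 := by
    have e : K * (η * (C + 1)) = ε / 4 := by
      rw [hη]
      field_simp
    rw [← e]
    gcongr
    linarith
  have h2 : Tendsto (fun n => K * ((4 * η)⁻¹ * ∫ ω, maxIncr M s t n ω ∂P)) atTop (𝓝 0) := by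
    simpa using (hκlim.const_mul (4 * η)⁻¹).const_mul K
  obtain ⟨N, hN⟩ := eventually_atTop.1 (h2.eventually_lt_const (show 0 < ε / 2 by positivity))
  refine ⟨N + 1, fun n hn => ?_⟩
  rw [dist_zero_right]
  refine (hbound η hη0 n (by omega)).trans_lt ?_
  have := hN n (by omega)
  linarith

/-- The joint law of a past variable and of the increment of a continuous martingale depends only
on the law of the past variable and on the quadratic variation, if the latter is deterministic. -/
theorem IsL4Martingale.integral_mul_exp_eq {Ω' : Type*} {mΩ' : MeasurableSpace Ω'}
    {P' : Measure Ω'} [IsProbabilityMeasure P'] {ℱ' : Filtration (Set.Icc (0 : ℝ) T) mΩ'}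
    {M' : Set.Icc (0 : ℝ) T → Ω' → ℝ} (h : IsL4Martingale P ℱ M A)
    (hcont : ∀ᵐ ω ∂P, Continuous fun t => M t ω) (h' : IsL4Martingale P' ℱ' M' A)
    (hcont' : ∀ᵐ ω ∂P', Continuous fun t => M' t ω) {s t : Set.Icc (0 : ℝ) T} (hst : s ≤ t)
    {Z : Ω → ℂ} (hZ : StronglyMeasurable[ℱ s] Z) (hZ1 : ∀ ω, ‖Z ω‖ ≤ 1)
    {Z' : Ω' → ℂ} (hZ' : StronglyMeasurable[ℱ' s] Z') (hZ1' : ∀ ω, ‖Z' ω‖ ≤ 1)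
    (hZZ' : ∫ ω, Z ω ∂P = ∫ ω, Z' ω ∂P') :
    ∫ ω, Z ω * Complex.exp ((M t ω - M s ω : ℝ) * Complex.I) ∂P
      = ∫ ω, Z' ω * Complex.exp ((M' t ω - M' s ω : ℝ) * Complex.I) ∂P' := by
  -- The products depend only on `A`, so they are the same on both sides and cancel; their limit is
  -- never computed.
  have h1 := (h.tendsto_integral_mul_exp hcont hst hZ hZ1).sub
    (h'.tendsto_integral_mul_exp hcont' hst hZ' hZ1')
  rw [hZZ', sub_zero] at h1
  simp only [sub_sub_sub_cancel_right] at h1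
  exact sub_eq_zero.1 (tendsto_nhds_unique tendsto_const_nhds h1)

end CharFun

/-! ### Time integrals of random fields -/

section Minkowski

variable {τ Ω : Type*} [MeasurableSpace τ] [MeasurableSpace Ω] {μ : Measure τ} {P : Measure Ω}
  [IsFiniteMeasure μ] {X : τ → Ω → ℝ} {p C : ℝ≥0∞}

/-- Jensen's inequality in time for each `ω`, then Tonelli. -/
theorem eLpNorm_integral_le [IsProbabilityMeasure P] (hX : Measurable (Function.uncurry X)) (hp1 : 1 ≤ p) (hp : p ≠ ∞)
    (hC : ∀ᵐ s ∂μ, eLpNorm (X s) p P ≤ C) :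
    eLpNorm (fun ω => ∫ s, X s ω ∂μ) p P ≤ μ Set.univ * C := by
  have hp0 : p ≠ 0 := (zero_lt_one.trans_le hp1).ne'
  set q := p.toReal with hq
  have hq1 : 1 ≤ q := by
    rw [hq, ← ENNReal.toReal_one]
    exact (ENNReal.toReal_le_toReal (by simp) hp).2 hp1
  have hq0 : 0 < q := zero_lt_one.trans_le hq1
  have hpow : ∀ f : Ω → ℝ, eLpNorm f p P ^ q = ∫⁻ ω, ‖f ω‖ₑ ^ q ∂P := by
    intro f
    rw [eLpNorm_eq_lintegral_rpow_enorm_toReal hp0 hp, ← ENNReal.rpow_mul, one_div,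
      inv_mul_cancel₀ hq0.ne', ENNReal.rpow_one]
  have hjensen : ∀ ω, ‖∫ s, X s ω ∂μ‖ₑ ^ q
      ≤ μ Set.univ ^ (q - 1) * ∫⁻ s, ‖X s ω‖ₑ ^ q ∂μ := by
    intro ω
    have hm : AEStronglyMeasurable (fun s => X s ω) μ :=
      (hX.of_uncurry_right (y := ω)).aestronglyMeasurable
    have h1 := eLpNorm'_le_eLpNorm'_mul_rpow_measure_univ (μ := μ) zero_lt_one hq1 hm
    simp only [eLpNorm', ENNReal.rpow_one, div_one] at h1
    calc _ ≤ (∫⁻ s, ‖X s ω‖ₑ ∂μ) ^ q := by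
          gcongr
          exact enorm_integral_le_lintegral_enorm _
      _ ≤ ((∫⁻ s, ‖X s ω‖ₑ ^ q ∂μ) ^ (1 / q) * μ Set.univ ^ (1 - 1 / q)) ^ q := by gcongr
      _ = _ := by
          rw [ENNReal.mul_rpow_of_nonneg _ _ hq0.le, ← ENNReal.rpow_mul, ← ENNReal.rpow_mul,
            one_div, inv_mul_cancel₀ hq0.ne', ENNReal.rpow_one, sub_mul, one_mul,
            inv_mul_cancel₀ hq0.ne', mul_comm]
  have hXm : Measurable (Function.uncurry fun ω s => ‖X s ω‖ₑ ^ q) :=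
    ((hX.comp measurable_swap).enorm).pow_const q
  have hXm' : Measurable fun ω => ∫⁻ s, ‖X s ω‖ₑ ^ q ∂μ := hXm.lintegral_prod_right'
  rw [← ENNReal.rpow_le_rpow_iff hq0, hpow, ENNReal.mul_rpow_of_nonneg _ _ hq0.le]
  calc _ ≤ ∫⁻ ω, μ Set.univ ^ (q - 1) * ∫⁻ s, ‖X s ω‖ₑ ^ q ∂μ ∂P := lintegral_mono hjensen
    _ = μ Set.univ ^ (q - 1) * ∫⁻ s, ∫⁻ ω, ‖X s ω‖ₑ ^ q ∂P ∂μ := by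
        rw [lintegral_const_mul _ hXm', lintegral_lintegral_swap hXm.aemeasurable]
    _ ≤ μ Set.univ ^ (q - 1) * ∫⁻ s, C ^ q ∂μ := by
        gcongr 1
        refine lintegral_mono_ae ?_
        filter_upwards [hC] with s hs
        rw [← hpow]
        gcongr
    _ = μ Set.univ ^ q * C ^ q := by
        rw [lintegral_const, mul_comm (C ^ q), ← mul_assoc]
        congr 1
        have := ENNReal.rpow_add_of_nonneg (x := μ Set.univ) (q - 1) 1 (by linarith) zero_le_one
        rw [ENNReal.rpow_one, sub_add_cancel] at this
        exact this.symm

/-- Needed because a non-integrable function has integral 0 by convention, which would break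
additivity of the time integrals. -/
theorem ae_integrable_of_eLpNorm_le [IsProbabilityMeasure P] (hX : Measurable (Function.uncurry X)) (hp1 : 1 ≤ p)
    (hC : ∀ᵐ s ∂μ, eLpNorm (X s) p P ≤ C) (hC' : C ≠ ∞) :
    ∀ᵐ ω ∂P, Integrable (fun s => X s ω) μ := by
  have hi : Integrable (Function.uncurry X) (μ.prod P) := by
    refine ⟨hX.aestronglyMeasurable, ?_⟩
    rw [hasFiniteIntegral_iff_enorm, lintegral_prod _ hX.enorm.aemeasurable]
    calc _ ≤ ∫⁻ s, C ∂μ := by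
          refine lintegral_mono_ae ?_
          filter_upwards [hC] with s hs
          have hm : AEStronglyMeasurable (X s) P :=
            (hX.of_uncurry_left (x := s)).aestronglyMeasurable
          refine le_trans ?_ hs
          have := eLpNorm_le_eLpNorm_of_exponent_le (μ := P) hp1 hm
          rwa [eLpNorm_one_eq_lintegral_enorm] at this
      _ < ∞ := by
          rw [lintegral_const]
          exact ENNReal.mul_lt_top hC'.lt_top (measure_lt_top _ _)
  exact hi.prod_left_ae

/-- Fatou along an almost surely convergent subsequence. The exponent `p` may exceed that of the
convergence: with `p = 4` it gives fourth moments to a drift defined as an `L²` limit. -/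
theorem eLpNorm_le_of_tendsto {F : ℝ → Ω → ℝ} {I : Ω → ℝ}
    (hF : ∀ ε, AEStronglyMeasurable (F ε) P) (hI : AEStronglyMeasurable I P)
    (hlim : Tendsto (fun ε => eLpNorm (fun ω => F ε ω - I ω) 2 P) (𝓝[>] 0) (𝓝 0))
    (hC : ∀ᶠ ε in 𝓝[>] 0, eLpNorm (F ε) p P ≤ C) : eLpNorm I p P ≤ C := by
  have hmeas : TendstoInMeasure P F (𝓝[>] 0) I :=
    tendstoInMeasure_of_tendsto_eLpNorm (by norm_num) hF hI hlim
  obtain ⟨u, hu⟩ := exists_seq_tendsto (𝓝[>] (0 : ℝ))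
  obtain ⟨ns, hns, hae⟩ := (show TendstoInMeasure P (fun n => F (u n)) atTop I from
    fun ε hε => (hmeas ε hε).comp hu).exists_seq_tendsto_ae
  refine (Lp.eLpNorm_lim_le_liminf_eLpNorm (fun n => hF _) I hae).trans ?_
  refine (liminf_le_liminf (v := fun _ => C) ?_).trans (by simp)
  exact (hu.comp hns.tendsto_atTop).eventually hC

end Minkowski

/-! ### White noise -/

section WhiteNoise

variable {Ω : Type*} [MeasurableSpace Ω] {P : Measure Ω} {χ : ℝ}

theorem measurable_eval (f : 𝓢(ℝ, ℝ)) : Measurable fun ω : TemperedDist => ω f :=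
  measurable_iff_comap_le.2 (le_iSup (fun f : 𝓢(ℝ, ℝ) =>
    MeasurableSpace.comap (fun ω : TemperedDist => ω f) (borel ℝ)) f)

theorem integral_sq_eq_norm_sq (f : 𝓢(ℝ, ℝ)) : ∫ x, f x ^ 2 = ‖schwartzToL2 f‖ ^ 2 := by
  rw [← real_inner_self_eq_norm_sq, L2.inner_def]
  refine integral_congr_ae ?_
  filter_upwards [coeFn_schwartzToL2 f] with x hx
  rw [hx]
  simp [pow_two]

/-- The constant in the `L^p` bound of a white noise of variance `χ`. -/
noncomputable def noiseConst (p : ℝ≥0∞) (χ : ℝ) : ℝ≥0∞ :=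
  ‖√χ‖ₑ * eLpNorm id p (gaussianReal 0 1)

theorem noiseConst_ne_top {p : ℝ≥0∞} (hp : p ≠ ∞) : noiseConst p χ ≠ ∞ :=
  ENNReal.mul_ne_top enorm_ne_top (memLp_id_gaussianReal' p hp).eLpNorm_ne_top

theorem IsWhiteNoise.measurable_apply {X : Ω → TemperedDist} (hX : IsWhiteNoise P χ X)
    (f : 𝓢(ℝ, ℝ)) : Measurable fun ω => X ω f :=
  (measurable_eval f).comp hX.1

/-- The variable has the law of `√χ ‖f‖` times a standard Gaussian, so every `L^p(P)` norm is
proportional to the `L²(ℝ)` norm of the test function. -/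
theorem IsWhiteNoise.eLpNorm_apply (hχ : 0 ≤ χ) {X : Ω → TemperedDist}
    (hX : IsWhiteNoise P χ X) (f : 𝓢(ℝ, ℝ)) (p : ℝ≥0∞) :
    eLpNorm (fun ω => X ω f) p P = noiseConst p χ * ENNReal.ofReal ‖schwartzToL2 f‖ := by
  have h := (hX.2 f).map_eq
  have h1 := gaussianReal_map_const_mul (μ := 0) (v := 1) (√χ * ‖schwartzToL2 f‖)
  have hv : (NNReal.mk ((√χ * ‖schwartzToL2 f‖) ^ 2) (sq_nonneg _) * 1 : ℝ≥0)
      = (χ * ∫ x, f x ^ 2).toNNReal := by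
    rw [mul_one, integral_sq_eq_norm_sq]
    apply NNReal.eq
    rw [Real.coe_toNNReal _ (by positivity)]
    simp [mul_pow, Real.sq_sqrt hχ]
  rw [mul_zero, hv, ← h] at h1
  have h2 : eLpNorm (fun ω => X ω f) p P
      = eLpNorm id p (P.map fun ω => X ω f) := by
    rw [eLpNorm_map_measure aestronglyMeasurable_id (hX.2 f).aemeasurable]
    rfl
  rw [h2, ← h1, eLpNorm_map_measure aestronglyMeasurable_id (by fun_prop)]
  have h3 : (id ∘ fun x : ℝ => √χ * ‖schwartzToL2 f‖ * x)
      = (√χ * ‖schwartzToL2 f‖) • (id : ℝ → ℝ) := rfl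
  rw [h3, eLpNorm_const_smul, enorm_mul, noiseConst, ← ofReal_norm ‖schwartzToL2 f‖,
    norm_norm]
  ring

end WhiteNoise

/-! ### The martingales of a stationary solution -/

instance isFiniteMeasure_timeMeasure (T : ℝ) : IsFiniteMeasure (timeMeasure T) := by
  refine ⟨?_⟩
  rw [timeMeasure, (MeasurableEmbedding.subtype_coe measurableSet_Icc).comap_apply]
  refine (measure_mono (t := Set.Icc (0 : ℝ) T) ?_).trans_lt (by simp)
  rintro _ ⟨x, -, rfl⟩
  exact x.2

section Solution

variable {Ω : Type*} [MeasurableSpace Ω] {P : Measure Ω}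
  {T α cp cm χ : ℝ} {hT : 0 < T} {Y : Set.Icc (0 : ℝ) T → Ω → TemperedDist}

theorem measurable_apply_finTraj (hY : Measurable (Function.uncurry Y)) (N : ℕ)
    {φ : ℕ → ℝ → ℝ} (hφ : ∀ k, Continuous (φ k)) (g : ℕ → 𝓢(ℝ, ℝ)) :
    Measurable (Function.uncurry fun (s : Set.Icc (0 : ℝ) T) ω => Y s ω (finTraj N φ g s)) := by
  have e : (Function.uncurry fun (s : Set.Icc (0 : ℝ) T) ω => Y s ω (finTraj N φ g s))
      = fun q : Set.Icc (0 : ℝ) T × Ω =>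
        ∑ k ∈ Finset.range N, φ k q.1 * (Function.uncurry Y q) (g k) := by
    ext q
    simp [Function.uncurry, finTraj]
  rw [e]
  refine Finset.measurable_fun_sum _ fun k _ => ?_
  have h1 : Measurable fun q : Set.Icc (0 : ℝ) T × Ω => φ k q.1 :=
    (hφ k).measurable.comp (measurable_subtype_coe.comp measurable_fst)
  exact h1.mul ((measurable_eval (g k)).comp hY)

theorem exists_norm_finTraj_le (T : ℝ) (N : ℕ) {φ : ℕ → ℝ → ℝ} (hφ : ∀ k, Continuous (φ k)) :
    ∃ B, 0 ≤ B ∧ ∀ (u : ℕ → L2Line) (s : Set.Icc (0 : ℝ) T),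
      ‖∑ k ∈ Finset.range N, φ k s • u k‖ ≤ B * ∑ k ∈ Finset.range N, ‖u k‖ := by
  have hb : ∀ k, ∃ B, 0 ≤ B ∧ ∀ s : Set.Icc (0 : ℝ) T, |φ k s| ≤ B := by
    intro k
    obtain ⟨B, hB⟩ := isCompact_Icc.exists_bound_of_continuousOn (s := Set.Icc (0 : ℝ) T)
      (hφ k).continuousOn
    exact ⟨|B|, abs_nonneg B, fun s => (hB s s.2).trans (le_abs_self B)⟩
  choose B hB0 hB using hb
  refine ⟨∑ k ∈ Finset.range N, B k, Finset.sum_nonneg fun k _ => hB0 k, fun u s => ?_⟩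
  rw [Finset.mul_sum]
  refine norm_sum_le_of_le _ fun k hk => ?_
  rw [norm_smul, Real.norm_eq_abs]
  gcongr
  exact (hB k s).trans (Finset.single_le_sum (fun k _ => hB0 k) hk)

theorem schwartzToL2_finTraj (N : ℕ) (φ : ℕ → ℝ → ℝ) (g : ℕ → 𝓢(ℝ, ℝ)) (s : ℝ) :
    schwartzToL2 (finTraj N φ g s) = ∑ k ∈ Finset.range N, φ k s • schwartzToL2 (g k) := by
  simp_rw [finTraj, map_sum, map_smul]

theorem IsStationarySolution.eLpNorm_integral_le [IsProbabilityMeasure P] (hχ : 0 ≤ χ)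
    (hY : IsStationarySolution hT cp cm α χ P Y) {h : Set.Icc (0 : ℝ) T → 𝓢(ℝ, ℝ)}
    (hm : Measurable (Function.uncurry fun s ω => Y s ω (h s))) {S : Set (Set.Icc (0 : ℝ) T)}
    (hS : MeasurableSet S) {B : ℝ} (hB : ∀ s ∈ S, ‖schwartzToL2 (h s)‖ ≤ B) {p : ℝ≥0∞}
    (hp1 : 1 ≤ p) (hp : p ≠ ∞) :
    eLpNorm (fun ω => ∫ s in S, Y s ω (h s) ∂timeMeasure T) p P
      ≤ timeMeasure T Set.univ * (noiseConst p χ * ENNReal.ofReal B) := by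
  refine (StableOU.eLpNorm_integral_le (μ := (timeMeasure T).restrict S) hm hp1 hp
    (C := noiseConst p χ * ENNReal.ofReal B) ?_).trans ?_
  · refine (ae_restrict_iff' hS).2 (.of_forall fun s hs => ?_)
    rw [(hY.whiteNoise s).eLpNorm_apply hχ]
    gcongr
    exact hB s hs
  · gcongr
    exact Measure.restrict_le_self

theorem IsStationarySolution.ae_integrable [IsProbabilityMeasure P] (hχ : 0 ≤ χ)
    (hY : IsStationarySolution hT cp cm α χ P Y) (N : ℕ) {φ : ℕ → ℝ → ℝ}
    (hφ : ∀ k, Continuous (φ k)) (g : ℕ → 𝓢(ℝ, ℝ)) :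
    ∀ᵐ ω ∂P, Integrable (fun s => Y s ω (finTraj N φ g s)) (timeMeasure T) := by
  obtain ⟨B, hB, H⟩ := exists_norm_finTraj_le T N hφ
  refine ae_integrable_of_eLpNorm_le (measurable_apply_finTraj hY.measurable N hφ g)
    (p := 2) (by norm_num) (C := noiseConst 2 χ * ENNReal.ofReal
      (B * ∑ k ∈ Finset.range N, ‖schwartzToL2 (g k)‖)) (.of_forall fun s => ?_) ?_
  · rw [(hY.whiteNoise s).eLpNorm_apply hχ, schwartzToL2_finTraj]
    gcongr
    exact H _ s
  · exact ENNReal.mul_ne_top (noiseConst_ne_top (by norm_num)) ENNReal.ofReal_ne_top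

theorem aestronglyMeasurable_timeIntegral {h : Set.Icc (0 : ℝ) T → 𝓢(ℝ, ℝ)}
    (hm : Measurable (Function.uncurry fun s ω => Y s ω (h s))) (S : Set (Set.Icc (0 : ℝ) T)) :
    AEStronglyMeasurable (fun ω => ∫ s in S, Y s ω (h s) ∂timeMeasure T) P := by
  have h1 : StronglyMeasurable (Function.uncurry fun ω s => Y s ω (h s)) :=
    (hm.comp measurable_swap).stronglyMeasurable
  exact (h1.integral_prod_right (ν := (timeMeasure T).restrict S)).aestronglyMeasurable

end Solution

section Martingale

variable {Ω : Type*} [MeasurableSpace Ω] {P : Measure Ω}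
  {T α cp cm χ : ℝ} {hT : 0 < T} {Y : Set.Icc (0 : ℝ) T → Ω → TemperedDist}

/-- The drift integral of a trajectory of finite rank, written with fixed Schwartz functions. -/
theorem IsDriftIntegral.tendsto_finTraj (h0 : 0 < α) (h2 : α < 2) {N : ℕ} {φ : ℕ → ℝ → ℝ}
    {g : ℕ → 𝓢(ℝ, ℝ)} {t : Set.Icc (0 : ℝ) T} {I : Ω → ℝ}
    (hI : IsDriftIntegral cp cm α P Y (fun s => finTraj N φ g s) t I) :
    Tendsto (fun ε : ℝ => eLpNorm (fun ω => (∫ s in Set.Iic t,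
      Y s ω (finTraj N φ (fun k => cutLevy cp cm α ε (g k)) s) ∂timeMeasure T) - I ω) 2 P)
      (𝓝[>] 0) (𝓝 0) := by
  refine hI.2.congr' ?_
  filter_upwards [self_mem_nhdsWithin] with ε hε
  simp_rw [cutLevy_finTraj cp cm h0 h2 hε]

/-- Finite rank makes the removal of the cutoff uniform in time. -/
theorem eventually_norm_finTraj_cutLevy_le (T : ℝ) (cp cm : ℝ) (h0 : 0 < α) (h2 : α < 2) (N : ℕ)
    {φ : ℕ → ℝ → ℝ} (hφ : ∀ k, Continuous (φ k)) (g : ℕ → 𝓢(ℝ, ℝ)) {δ : ℝ} (hδ : 0 < δ) :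
    ∀ᶠ ε in 𝓝[>] (0 : ℝ), ∀ s : Set.Icc (0 : ℝ) T,
      ‖schwartzToL2 (finTraj N φ (fun k => cutLevy cp cm α ε (g k)) s)
        - ∑ k ∈ Finset.range N, φ k s • levyL2 cp cm h0 h2 (g k)‖ ≤ δ := by
  obtain ⟨B, hB, H⟩ := exists_norm_finTraj_le T N hφ
  have hlim : Tendsto (fun ε => B * ∑ k ∈ Finset.range N,
      ‖schwartzToL2 (cutLevy cp cm α ε (g k)) - levyL2 cp cm h0 h2 (g k)‖) (𝓝[>] 0) (𝓝 0) := by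
    have h : ∀ k, Tendsto (fun ε =>
        ‖schwartzToL2 (cutLevy cp cm α ε (g k)) - levyL2 cp cm h0 h2 (g k)‖) (𝓝[>] 0) (𝓝 0) :=
      fun k => tendsto_iff_norm_sub_tendsto_zero.1 (tendsto_cutLevy cp cm h0 h2 (g k))
    simpa using (tendsto_finsetSum (Finset.range N) fun k _ => h k).const_mul B
  filter_upwards [hlim.eventually_le_const hδ] with ε hε s
  refine le_trans ?_ hε
  refine le_trans (le_of_eq ?_) (H (fun k =>
    schwartzToL2 (cutLevy cp cm α ε (g k)) - levyL2 cp cm h0 h2 (g k)) s)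
  simp_rw [schwartzToL2_finTraj, smul_sub, Finset.sum_sub_distrib]

theorem IsStationarySolution.memLp_timeIntegral [IsProbabilityMeasure P] (hχ : 0 ≤ χ)
    (hY : IsStationarySolution hT cp cm α χ P Y) (N : ℕ) {φ : ℕ → ℝ → ℝ}
    (hφ : ∀ k, Continuous (φ k)) (g : ℕ → 𝓢(ℝ, ℝ)) (t : Set.Icc (0 : ℝ) T) :
    MemLp (fun ω => ∫ s in Set.Iic t, Y s ω (finTraj N φ g s) ∂timeMeasure T) 4 P := by
  obtain ⟨B, hB, H⟩ := exists_norm_finTraj_le T N hφ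
  have hm := measurable_apply_finTraj hY.measurable N hφ g
  refine ⟨aestronglyMeasurable_timeIntegral hm _, ?_⟩
  refine (hY.eLpNorm_integral_le hχ hm measurableSet_Iic
    (B := B * ∑ k ∈ Finset.range N, ‖schwartzToL2 (g k)‖) (fun s _ => ?_)
    (by norm_num) (by norm_num)).trans_lt ?_
  · rw [schwartzToL2_finTraj]
    exact H _ s
  · exact ENNReal.mul_lt_top (measure_lt_top _ _)
      (ENNReal.mul_lt_top (noiseConst_ne_top (by norm_num)).lt_top ENNReal.ofReal_lt_top)

theorem IsStationarySolution.memLp_driftIntegral [IsProbabilityMeasure P] (hχ : 0 ≤ χ) (h0 : 0 < α) (h2 : α < 2)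
    (hY : IsStationarySolution hT cp cm α χ P Y) {N : ℕ} {φ : ℕ → ℝ → ℝ}
    (hφ : ∀ k, Continuous (φ k)) {g : ℕ → 𝓢(ℝ, ℝ)} {t : Set.Icc (0 : ℝ) T} {I : Ω → ℝ}
    (hI : IsDriftIntegral cp cm α P Y (fun s => finTraj N φ g s) t I) : MemLp I 4 P := by
  obtain ⟨B, hB, H⟩ := exists_norm_finTraj_le T N hφ
  have hm := fun ε => measurable_apply_finTraj hY.measurable N hφ
    (fun k => cutLevy cp cm α ε (g k))
  refine ⟨hI.1.aestronglyMeasurable, ?_⟩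
  refine (eLpNorm_le_of_tendsto (p := 4) (C := timeMeasure T Set.univ * (noiseConst 4 χ
    * ENNReal.ofReal (B * ∑ k ∈ Finset.range N, ‖levyL2 cp cm h0 h2 (g k)‖ + 1)))
    (fun ε => aestronglyMeasurable_timeIntegral (hm ε) _)
    hI.1.aestronglyMeasurable (hI.tendsto_finTraj h0 h2) ?_).trans_lt ?_
  · filter_upwards [eventually_norm_finTraj_cutLevy_le T cp cm h0 h2 N hφ g one_pos] with ε hε
    refine hY.eLpNorm_integral_le hχ (hm ε) measurableSet_Iic (fun s _ => ?_)
      (by norm_num) (by norm_num)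
    have h3 := norm_le_norm_add_norm_sub'
      (schwartzToL2 (finTraj N φ (fun k => cutLevy cp cm α ε (g k)) s))
      (∑ k ∈ Finset.range N, φ k s • levyL2 cp cm h0 h2 (g k))
    linarith [hε s, H (fun k => levyL2 cp cm h0 h2 (g k)) s]
  · exact ENNReal.mul_lt_top (measure_lt_top _ _)
      (ENNReal.mul_lt_top (noiseConst_ne_top (by norm_num)).lt_top ENNReal.ofReal_lt_top)

/-- If a trajectory of finite rank solves the backward equation on `(s, t]` up to an error of
size `δ` in `L²(ℝ)`, then the drift part of the associated martingale is small. -/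
theorem IsStationarySolution.eLpNorm_drift_le [IsProbabilityMeasure P] (hχ : 0 ≤ χ) (h0 : 0 < α) (h2 : α < 2)
    (hY : IsStationarySolution hT cp cm α χ P Y) {N : ℕ} {φ φ' : ℕ → ℝ → ℝ}
    (hφ : ∀ k, Continuous (φ k)) (hφ' : ∀ k, Continuous (φ' k)) {g : ℕ → 𝓢(ℝ, ℝ)}
    {s t : Set.Icc (0 : ℝ) T} (hst : s ≤ t) {I J : Ω → ℝ}
    (hI : IsDriftIntegral cp cm α P Y (fun s => finTraj N φ g s) s I)
    (hJ : IsDriftIntegral cp cm α P Y (fun s => finTraj N φ g s) t J) {δ : ℝ} (hδ : 0 < δ)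
    (hsmall : ∀ r ∈ Set.Ioc s t, ‖∑ k ∈ Finset.range N, (φ' k r • schwartzToL2 (g k)
      + φ k r • levyL2 cp cm h0 h2 (g k))‖ ≤ δ) :
    eLpNorm (fun ω => (∫ r in Set.Iic t, Y r ω (finTraj N φ' g r) ∂timeMeasure T) + J ω
      - ((∫ r in Set.Iic s, Y r ω (finTraj N φ' g r) ∂timeMeasure T) + I ω)) 2 P
      ≤ timeMeasure T Set.univ * (noiseConst 2 χ * ENNReal.ofReal (2 * δ)) := by
  have hm' := measurable_apply_finTraj hY.measurable N hφ' g
  have hm := fun ε => measurable_apply_finTraj hY.measurable N hφ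
    (fun k => cutLevy cp cm α ε (g k))
  have hsum : ∀ ε, Measurable (Function.uncurry fun (r : Set.Icc (0 : ℝ) T) ω =>
      Y r ω (finTraj N φ' g r + finTraj N φ (fun k => cutLevy cp cm α ε (g k)) r)) := by
    intro ε
    have e : (Function.uncurry fun (r : Set.Icc (0 : ℝ) T) ω =>
        Y r ω (finTraj N φ' g r + finTraj N φ (fun k => cutLevy cp cm α ε (g k)) r))
        = (Function.uncurry fun (r : Set.Icc (0 : ℝ) T) ω => Y r ω (finTraj N φ' g r))
          + (Function.uncurry fun (r : Set.Icc (0 : ℝ) T) ω =>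
            Y r ω (finTraj N φ (fun k => cutLevy cp cm α ε (g k)) r)) := by
      ext q
      simp [Function.uncurry]
    rw [e]
    exact hm'.add (hm ε)
  -- The drift over `(s, t]` is the `L²(P)` limit of the cut off integrals. Their integrands have
  -- size at most `2δ` in `L²(ℝ)`: one `δ` from the backward equation, one from the cutoff.
  refine eLpNorm_le_of_tendsto (p := 2) (F := fun ε ω => ∫ r in Set.Ioc s t,
      Y r ω (finTraj N φ' g r + finTraj N φ (fun k => cutLevy cp cm α ε (g k)) r) ∂timeMeasure T)
    (fun ε => aestronglyMeasurable_timeIntegral (hsum ε) _)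
    (((aestronglyMeasurable_timeIntegral hm' _).add hJ.1.aestronglyMeasurable).sub
      ((aestronglyMeasurable_timeIntegral hm' _).add hI.1.aestronglyMeasurable)) ?_ ?_
  · have hlim := (hJ.tendsto_finTraj h0 h2).add (hI.tendsto_finTraj h0 h2)
    rw [add_zero] at hlim
    refine tendsto_of_tendsto_of_tendsto_of_le_of_le tendsto_const_nhds hlim
      (fun _ => bot_le) fun ε => ?_
    refine le_trans (le_of_eq (eLpNorm_congr_ae ?_)) (eLpNorm_sub_le
      ((aestronglyMeasurable_timeIntegral (hm ε) _).sub hJ.1.aestronglyMeasurable)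
      ((aestronglyMeasurable_timeIntegral (hm ε) _).sub hI.1.aestronglyMeasurable) (by norm_num))
    filter_upwards [hY.ae_integrable hχ N hφ' g,
      hY.ae_integrable hχ N hφ (fun k => cutLevy cp cm α ε (g k))] with ω i1 i2
    simp only [map_add, Pi.sub_apply]
    rw [integral_add i1.integrableOn i2.integrableOn, ← Set.Iic_sdiff_Iic,
      setIntegral_sdiff measurableSet_Iic i1.integrableOn (Set.Iic_subset_Iic.2 hst),
      setIntegral_sdiff measurableSet_Iic i2.integrableOn (Set.Iic_subset_Iic.2 hst)]
    ring
  · filter_upwards [eventually_norm_finTraj_cutLevy_le T cp cm h0 h2 N hφ g hδ] with ε hε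
    refine hY.eLpNorm_integral_le hχ (hsum ε) measurableSet_Ioc (fun r hr => ?_)
      (by norm_num) (by norm_num)
    have e : schwartzToL2 (finTraj N φ' g r + finTraj N φ (fun k => cutLevy cp cm α ε (g k)) r)
        = ∑ k ∈ Finset.range N, (φ' k r • schwartzToL2 (g k)
            + φ k r • levyL2 cp cm h0 h2 (g k))
          + (schwartzToL2 (finTraj N φ (fun k => cutLevy cp cm α ε (g k)) r)
            - ∑ k ∈ Finset.range N, φ k r • levyL2 cp cm h0 h2 (g k)) := by
      rw [map_add, schwartzToL2_finTraj N φ' g, Finset.sum_add_distrib]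
      abel
    rw [e]
    refine (norm_add_le _ _).trans ?_
    linarith [hsmall r hr, hε r]

/-- In `M_t - M_s` the terms at time 0 cancel, and what separates it from `Y_t(f_t) - Y_s(f_s)` is
the drift over `(s, t]`. The compensator depends only on the trajectory and the parameters, hence is
common to all solutions. -/
theorem IsStationarySolution.exists_martingale [IsProbabilityMeasure P] (hχ : 0 ≤ χ) (h0 : 0 < α) (h2 : α < 2)
    (hY : IsStationarySolution hT cp cm α χ P Y) {N : ℕ} {φ φ' : ℕ → ℝ → ℝ} {g : ℕ → 𝓢(ℝ, ℝ)}
    (hφ : ∀ k s, HasDerivAt (φ k) (φ' k s) s) (hφ' : ∀ k, Continuous (φ' k)) :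
    ∃ M : Set.Icc (0 : ℝ) T → Ω → ℝ,
      IsL4Martingale P (naturalFiltration P Y fun t => (hY.whiteNoise t).1) M
        (fun t => 2 * χ * ∫ s in Set.Iic t,
          (∫ x, finTraj N φ g s x * -levySym cp cm α (finTraj N φ g s) x) ∂timeMeasure T) ∧
      (∀ᵐ ω ∂P, Continuous fun t => M t ω) ∧
      ∀ s t : Set.Icc (0 : ℝ) T, s ≤ t → ∀ δ > 0,
        (∀ r ∈ Set.Ioc s t, ‖∑ k ∈ Finset.range N, (φ' k r • schwartzToL2 (g k)
          + φ k r • levyL2 cp cm h0 h2 (g k))‖ ≤ δ) →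
        eLpNorm (fun ω => Y t ω (finTraj N φ g t) - Y s ω (finTraj N φ g s) - (M t ω - M s ω)) 2 P
          ≤ timeMeasure T Set.univ * (noiseConst 2 χ * ENNReal.ofReal (2 * δ)) := by
  obtain ⟨I, M, hI, hM, hcont, hmart, hsq⟩ :=
    hY.martingale _ _ (isTestTrajectory_finTraj T N g hφ hφ')
  have hφc : ∀ k, Continuous (φ k) := fun k =>
    (show Differentiable ℝ (φ k) from fun s => (hφ k s).differentiableAt).continuous
  refine ⟨M, ⟨hmart, hsq, fun t => ?_⟩, hcont, fun s t hst δ hδ hsmall => ?_⟩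
  · have hmem : ∀ t : Set.Icc (0 : ℝ) T, MemLp (fun ω => Y t ω (finTraj N φ g t)) 4 P := by
      intro t
      refine ⟨((hY.whiteNoise t).measurable_apply _).aestronglyMeasurable, ?_⟩
      rw [(hY.whiteNoise t).eLpNorm_apply hχ]
      exact ENNReal.mul_lt_top (noiseConst_ne_top (by norm_num)).lt_top ENNReal.ofReal_lt_top
    refine (memLp_congr_ae (hM t)).2 ?_
    exact ((hmem t).sub (hmem (initialTime hT))).sub
      ((hY.memLp_timeIntegral hχ N hφ' g t).add (hY.memLp_driftIntegral hχ h0 h2 hφc (hI t)))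
  · refine le_trans (le_of_eq (eLpNorm_congr_ae ?_))
      (hY.eLpNorm_drift_le hχ h0 h2 hφc hφ' hst (hI s) (hI t) hδ hsmall)
    filter_upwards [hM s, hM t] with ω e1 e2
    rw [e1, e2]
    ring

theorem measurable_pastSigma_apply (P : Measure Ω) {r t : Set.Icc (0 : ℝ) T} (hrt : r ≤ t)
    (f : 𝓢(ℝ, ℝ)) : Measurable[pastSigma P Y t] fun ω => Y r ω f := by
  have h1 : Measurable[pastSigma P Y t] (Y r) := by
    refine measurable_iff_comap_le.2 (le_trans ?_ le_sup_left)
    exact le_iSup₂_of_le r hrt le_rfl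
  exact (measurable_eval f).comp h1

end Martingale

/-! ### Uniqueness of the finite-dimensional laws -/

section Uniqueness

variable {Ω Ω' : Type*} [MeasurableSpace Ω] [MeasurableSpace Ω'] {P : Measure Ω}
  {P' : Measure Ω'} {T α cp cm χ : ℝ}
  {hT : 0 < T} {Y : Set.Icc (0 : ℝ) T → Ω → TemperedDist}
  {Y' : Set.Icc (0 : ℝ) T → Ω' → TemperedDist}

theorem norm_exp_mul_I_sub_exp_mul_I_le (x y : ℝ) :
    ‖Complex.exp (x * Complex.I) - Complex.exp (y * Complex.I)‖ ≤ |x - y| := by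
  have e : Complex.exp (x * Complex.I) - Complex.exp (y * Complex.I)
      = Complex.exp (y * Complex.I) * (Complex.exp (Complex.I * (x - y : ℝ)) - 1) := by
    rw [mul_sub, ← Complex.exp_add, mul_one]
    congr 2
    push_cast
    ring
  rw [e, norm_mul, Complex.norm_exp_ofReal_mul_I, one_mul]
  exact Real.norm_exp_I_mul_ofReal_sub_one_le

theorem norm_integral_exp_sub_le [IsProbabilityMeasure P] {X X' : Ω → ℝ} (hX : AEStronglyMeasurable X P)
    (hX' : AEStronglyMeasurable X' P) {C : ℝ≥0∞} (hC : C ≠ ∞)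
    (h : eLpNorm (fun ω => X ω - X' ω) 2 P ≤ C) :
    ‖∫ ω, Complex.exp (X ω * Complex.I) ∂P - ∫ ω, Complex.exp (X' ω * Complex.I) ∂P‖
      ≤ C.toReal := by
  have hi : ∀ {X : Ω → ℝ}, AEStronglyMeasurable X P →
      Integrable (fun ω => Complex.exp (X ω * Complex.I)) P := fun {X} hX =>
    Integrable.of_bound ((by fun_prop : Continuous fun x : ℝ =>
      Complex.exp (x * Complex.I)).comp_aestronglyMeasurable hX) 1
      (.of_forall fun ω => (Complex.norm_exp_ofReal_mul_I _).le)
  have h1 : eLpNorm (fun ω => X ω - X' ω) 1 P ≤ C :=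
    (eLpNorm_le_eLpNorm_of_exponent_le (by norm_num) (hX.sub hX')).trans h
  have hd : Integrable (fun ω => X ω - X' ω) P :=
    memLp_one_iff_integrable.1 ⟨hX.sub hX', h1.trans_lt hC.lt_top⟩
  rw [← integral_sub (hi hX) (hi hX')]
  refine (norm_integral_le_of_norm_le hd.norm
    (.of_forall fun ω => norm_exp_mul_I_sub_exp_mul_I_le _ _)).trans ?_
  rw [integral_norm_eq_lintegral_enorm hd.aestronglyMeasurable, ← eLpNorm_one_eq_lintegral_enorm]
  exact ENNReal.toReal_mono hC h1

theorem IsStationarySolution.measurable_sum (hY : IsStationarySolution hT cp cm α χ P Y)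
    (J : Finset (Set.Icc (0 : ℝ) T)) (F : Set.Icc (0 : ℝ) T → 𝓢(ℝ, ℝ)) :
    Measurable fun ω => ∑ t ∈ J, Y t ω (F t) :=
  Finset.measurable_fun_sum _ fun t _ => (hY.whiteNoise t).measurable_apply (F t)

/-- The characteristic function of a solution at finitely many times is close to one which
involves the earlier times and an increment of the martingale of a trajectory. -/
theorem IsStationarySolution.norm_integral_exp_insert_sub_le [IsProbabilityMeasure P]
    (hY : IsStationarySolution hT cp cm α χ P Y) {J : Finset (Set.Icc (0 : ℝ) T)}
    {s t : Set.Icc (0 : ℝ) T} (hs : s ∈ J) (ht : t ∉ J) (F : Set.Icc (0 : ℝ) T → 𝓢(ℝ, ℝ))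
    (v : 𝓢(ℝ, ℝ)) {D : Ω → ℝ} (hD : AEStronglyMeasurable D P) {C : ℝ≥0∞} (hC : C ≠ ∞)
    (h : eLpNorm (fun ω => Y t ω (F t) - Y s ω v - D ω) 2 P ≤ C) :
    ‖∫ ω, Complex.exp ((∑ r ∈ insert t J, Y r ω (F r) : ℝ) * Complex.I) ∂P
      - ∫ ω, Complex.exp ((∑ r ∈ J, Y r ω (Function.update F s (F s + v) r) : ℝ) * Complex.I)
        * Complex.exp (D ω * Complex.I) ∂P‖ ≤ C.toReal := by
  have hm := hY.measurable_sum
  -- By linearity of `Y_s`, the term `Y_s(v)` is a change of the test function at time `s`.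
  have e1 : ∀ ω, ∑ r ∈ J, Y r ω (Function.update F s (F s + v) r)
      = ∑ r ∈ J, Y r ω (F r) + Y s ω v := by
    intro ω
    rw [← Finset.add_sum_erase _ _ hs, ← Finset.add_sum_erase _ (fun r => Y r ω (F r)) hs,
      Function.update_self, map_add]
    have : ∑ r ∈ J.erase s, Y r ω (Function.update F s (F s + v) r)
        = ∑ r ∈ J.erase s, Y r ω (F r) :=
      Finset.sum_congr rfl fun r hr => by rw [Function.update_of_ne (Finset.ne_of_mem_erase hr)]
    rw [this]
    ring
  have e2 : ∀ ω, Complex.exp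
        ((∑ r ∈ J, Y r ω (Function.update F s (F s + v) r) : ℝ) * Complex.I)
        * Complex.exp (D ω * Complex.I)
      = Complex.exp ((∑ r ∈ J, Y r ω (Function.update F s (F s + v) r) + D ω : ℝ)
        * Complex.I) := by
    intro ω
    rw [← Complex.exp_add]
    congr 1
    push_cast
    ring
  simp_rw [e2]
  refine norm_integral_exp_sub_le (X' := fun ω =>
      ∑ r ∈ J, Y r ω (Function.update F s (F s + v) r) + D ω) (hm _ F).aestronglyMeasurable
    ((hm _ _).aestronglyMeasurable.add hD) hC ?_
  refine le_trans (le_of_eq (eLpNorm_congr_ae (.of_forall fun ω => ?_))) h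
  simp only
  rw [Finset.sum_insert ht, e1]
  ring

/-- The induction hypothesis is needed for all `F`, since removing the last time modifies the test
function at the preceding one. -/
theorem integral_exp_sum_eq [IsProbabilityMeasure P] [IsProbabilityMeasure P']
    (h0 : 0 < α) (h2 : α < 2) (hcp : 0 ≤ cp) (hcm : 0 ≤ cm) (hχ : 0 < χ) (hY : IsStationarySolution hT cp cm α χ P Y)
    (hY' : IsStationarySolution hT cp cm α χ P' Y') (J : Finset (Set.Icc (0 : ℝ) T)) :
    ∀ F : Set.Icc (0 : ℝ) T → 𝓢(ℝ, ℝ),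
      ∫ ω, Complex.exp ((∑ t ∈ J, Y t ω (F t) : ℝ) * Complex.I) ∂P
        = ∫ ω, Complex.exp ((∑ t ∈ J, Y' t ω (F t) : ℝ) * Complex.I) ∂P' := by
  induction J using Finset.induction_on_max with
  | empty => simp
  | insert t J hmax ih =>
    intro F
    have htJ : t ∉ J := fun h => lt_irrefl _ (hmax t h)
    -- With no earlier time there is nothing to condition on; the Gaussian law at time `t` is used
    -- instead.
    rcases J.eq_empty_or_nonempty with rfl | hne
    · simp only [insert_empty_eq, Finset.sum_singleton]
      have hc : AEStronglyMeasurable (fun x : ℝ => Complex.exp (x * Complex.I))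
          (gaussianReal 0 (χ * ∫ x, F t x ^ 2).toNNReal) :=
        Continuous.aestronglyMeasurable (by fun_prop)
      have h1 := ((hY.whiteNoise t).2 (F t)).integral_comp hc
      have h3 := ((hY'.whiteNoise t).2 (F t)).integral_comp hc
      exact h1.trans h3.symm
    set s := J.max' hne with hs
    have hsJ : s ∈ J := J.max'_mem hne
    have hst : s ≤ t := (hmax s hsJ).le
    set K := timeMeasure T Set.univ * noiseConst 2 χ with hK
    have hKtop : K ≠ ∞ := ENNReal.mul_ne_top (measure_ne_top _ _) (noiseConst_ne_top (by norm_num))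
    have key : ∀ δ > 0, ‖∫ ω, Complex.exp ((∑ r ∈ insert t J, Y r ω (F r) : ℝ) * Complex.I) ∂P
        - ∫ ω, Complex.exp ((∑ r ∈ insert t J, Y' r ω (F r) : ℝ) * Complex.I) ∂P'‖
        ≤ δ * (4 * K.toReal) := by
      intro δ hδ
      -- One trajectory serves both solutions, so the two martingales share their quadratic
      -- variation. Each solution contributes an error `2δK`, whence the constant 4.
      obtain ⟨N, g, φ, φ', hφ, hφ', hend, hsmall⟩ :=
        exists_approx_backward hcp hcm h0 h2 (F t) t.2.1 hδ
      have hsm : ∀ r ∈ Set.Ioc s t, ‖∑ k ∈ Finset.range N, (φ' k r • schwartzToL2 (g k)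
          + φ k r • levyL2 cp cm h0 h2 (g k))‖ ≤ δ := fun r hr => hsmall r ⟨r.2.1, hr.2⟩
      obtain ⟨M, hM, hMc, hMd⟩ := hY.exists_martingale hχ.le h0 h2 (g := g) (N := N) hφ hφ'
      obtain ⟨M', hM', hMc', hMd'⟩ := hY'.exists_martingale hχ.le h0 h2 (g := g) (N := N) hφ hφ'
      have b := hMd s t hst δ hδ hsm
      have b' := hMd' s t hst δ hδ hsm
      rw [← mul_assoc, ← hK] at b b'
      have hfin : finTraj N φ g t = F t := hend
      rw [hfin] at b b'
      have hC : K * ENNReal.ofReal (2 * δ) ≠ ∞ := ENNReal.mul_ne_top hKtop ENNReal.ofReal_ne_top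
      have d := hY.norm_integral_exp_insert_sub_le hsJ htJ F _
        (hM.memLp_incr s t).aestronglyMeasurable hC b
      have d' := hY'.norm_integral_exp_insert_sub_le hsJ htJ F _
        (hM'.memLp_incr s t).aestronglyMeasurable hC b'
      set F' := Function.update F s (F s + finTraj N φ g s) with hF'
      have hcont : Continuous fun x : ℝ => Complex.exp (x * Complex.I) := by fun_prop
      have hZ : StronglyMeasurable[naturalFiltration P Y (fun t => (hY.whiteNoise t).1) s]
          fun ω => Complex.exp ((∑ r ∈ J, Y r ω (F' r) : ℝ) * Complex.I) :=
        hcont.comp_stronglyMeasurable (Measurable.stronglyMeasurable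
          (Finset.measurable_fun_sum _ fun r hr =>
            measurable_pastSigma_apply P (J.le_max' r hr) (F' r)))
      have hZ' : StronglyMeasurable[naturalFiltration P' Y' (fun t => (hY'.whiteNoise t).1) s]
          fun ω => Complex.exp ((∑ r ∈ J, Y' r ω (F' r) : ℝ) * Complex.I) :=
        hcont.comp_stronglyMeasurable (Measurable.stronglyMeasurable
          (Finset.measurable_fun_sum _ fun r hr =>
            measurable_pastSigma_apply P' (J.le_max' r hr) (F' r)))
      have heq := hM.integral_mul_exp_eq hMc hM' hMc' hst hZ
        (fun ω => (Complex.norm_exp_ofReal_mul_I _).le) hZ'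
        (fun ω => (Complex.norm_exp_ofReal_mul_I _).le) (ih F')
      rw [heq] at d
      have hCr : (K * ENNReal.ofReal (2 * δ)).toReal = K.toReal * (2 * δ) := by
        rw [ENNReal.toReal_mul, ENNReal.toReal_ofReal (by positivity)]
      rw [hCr] at d d'
      rw [norm_sub_rev] at d'
      have tri := norm_sub_le_norm_sub_add_norm_sub
        (∫ ω, Complex.exp ((∑ r ∈ insert t J, Y r ω (F r) : ℝ) * Complex.I) ∂P)
        (∫ ω, Complex.exp ((∑ r ∈ J, Y' r ω (F' r) : ℝ) * Complex.I)
          * Complex.exp ((M' t ω - M' s ω : ℝ) * Complex.I) ∂P')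
        (∫ ω, Complex.exp ((∑ r ∈ insert t J, Y' r ω (F r) : ℝ) * Complex.I) ∂P')
      linarith
    have hlim : Tendsto (fun δ : ℝ => δ * (4 * K.toReal)) (𝓝[>] 0) (𝓝 0) := by
      have : Continuous fun δ : ℝ => δ * (4 * K.toReal) := by fun_prop
      simpa using (this.tendsto 0).mono_left nhdsWithin_le_nhds
    have hle := ge_of_tendsto hlim (by filter_upwards [self_mem_nhdsWithin] with δ hδ
                                       using key δ hδ)
    exact sub_eq_zero.1 (norm_le_zero_iff.1 hle)

end Uniqueness

/-! ### From characteristic functions to the law on path space. -/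

section Law

variable {Ω Ω' τ : Type*} [MeasurableSpace Ω] [MeasurableSpace Ω'] {P : Measure Ω}
  {P' : Measure Ω'} {Y : τ → Ω → TemperedDist} {Y' : τ → Ω' → TemperedDist}

/-- The values of a distribution-valued path at all times and all test functions. -/
noncomputable def pathEval (w : τ → TemperedDist) (q : τ × 𝓢(ℝ, ℝ)) : ℝ := w q.1 q.2

/-- Both σ-algebras are generated by the real coordinates `w ↦ w t f`. It is thus enough to compare
laws on a product of real lines, where finite-dimensional marginals determine the measure. -/
theorem pi_eq_comap_pathEval : (MeasurableSpace.pi : MeasurableSpace (τ → TemperedDist))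
    = MeasurableSpace.comap pathEval MeasurableSpace.pi := by
  simp only [MeasurableSpace.pi, instMeasurableSpaceTemperedDist, MeasurableSpace.comap_iSup,
    MeasurableSpace.comap_comp, iSup_prod]
  rfl

theorem measurable_pathEval : Measurable (pathEval (τ := τ)) :=
  measurable_iff_comap_le.2 pi_eq_comap_pathEval.ge

/-- Two distribution-valued processes whose finite linear combinations have the same
characteristic functions have the same law. -/
theorem identDistrib_of_integral_exp_eq [IsProbabilityMeasure P] [IsProbabilityMeasure P']
    (hY : ∀ t, Measurable (Y t)) (hY' : ∀ t, Measurable (Y' t))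
    (h : ∀ (J : Finset τ) (F : τ → 𝓢(ℝ, ℝ)),
      ∫ ω, Complex.exp ((∑ t ∈ J, Y t ω (F t) : ℝ) * Complex.I) ∂P
        = ∫ ω, Complex.exp ((∑ t ∈ J, Y' t ω (F t) : ℝ) * Complex.I) ∂P') :
    IdentDistrib (fun ω t => Y t ω) (fun ω t => Y' t ω) P P' := by
  classical
  have m : Measurable fun ω t => Y t ω := measurable_pi_lambda _ hY
  have m' : Measurable fun ω t => Y' t ω := measurable_pi_lambda _ hY'
  have e : Measurable fun ω => pathEval fun t => Y t ω := measurable_pathEval.comp m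
  have e' : Measurable fun ω => pathEval fun t => Y' t ω := measurable_pathEval.comp m'
  have hmap : P.map (fun ω => pathEval fun t => Y t ω)
      = P'.map (fun ω => pathEval fun t => Y' t ω) := by
    have l := isProjectiveLimit_map (P := P)
      (X := fun q ω => pathEval (fun t => Y t ω) q) e.aemeasurable
    have l' := isProjectiveLimit_map (P := P')
      (X := fun q ω => pathEval (fun t => Y' t ω) q) e'.aemeasurable
    have hI : ∀ I : Finset (τ × 𝓢(ℝ, ℝ)),
        P.map (fun ω => I.restrict (pathEval fun t => Y t ω))
          = P'.map (fun ω => I.restrict (pathEval fun t => Y' t ω)) := by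
      intro I
      have r : Measurable fun ω => I.restrict (pathEval fun t => Y t ω) :=
        (Finset.measurable_restrict I).comp e
      have r' : Measurable fun ω => I.restrict (pathEval fun t => Y' t ω) :=
        (Finset.measurable_restrict I).comp e'
      have := Measure.isProbabilityMeasure_map (μ := P) r.aemeasurable
      have := Measure.isProbabilityMeasure_map (μ := P') r'.aemeasurable
      refine Measure.ext_of_charFunDual ?_
      ext L
      have hc : Continuous fun x : I → ℝ => Complex.exp (L x * Complex.I) := by fun_prop
      rw [charFunDual_apply, charFunDual_apply,
        integral_map r.aemeasurable hc.aestronglyMeasurable,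
        integral_map r'.aemeasurable hc.aestronglyMeasurable]
      -- A linear functional of finitely many coordinates `(t, f)` is grouped by time: by linearity
      -- of `w t`, all test functions attached to `t` merge into one.
      set F : τ → 𝓢(ℝ, ℝ) := fun t =>
        ∑ i : I with i.1.1 = t, L (Pi.single i 1) • i.1.2 with hF
      have key : ∀ w : τ → TemperedDist, L (I.restrict (pathEval w))
          = ∑ t ∈ I.image Prod.fst, w t (F t) := by
        intro w
        have h1 : L (I.restrict (pathEval w))
            = ∑ i : I, L (Pi.single i 1) * w i.1.1 i.1.2 := by
          conv_lhs => rw [← Finset.univ_sum_single (I.restrict (pathEval w))]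
          rw [map_sum]
          refine Finset.sum_congr rfl fun i _ => ?_
          have h2 : (Pi.single i (I.restrict (pathEval w) i) : I → ℝ)
              = w i.1.1 i.1.2 • Pi.single i 1 := by
            rw [← Pi.single_smul, smul_eq_mul, mul_one]
            rfl
          rw [h2, map_smul, smul_eq_mul, mul_comm]
        rw [h1, ← Finset.sum_fiberwise_of_maps_to (g := fun i : I => i.1.1)
          (t := I.image Prod.fst) fun i _ => Finset.mem_image_of_mem _ i.2]
        refine Finset.sum_congr rfl fun t _ => ?_
        rw [hF, map_sum]
        refine Finset.sum_congr rfl fun i hi => ?_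
        rw [map_smul, smul_eq_mul, (Finset.mem_filter.1 hi).2]
      simp_rw [key]
      exact h _ F
    simp_rw [hI] at l
    exact l.unique l'
  refine ⟨m.aemeasurable, m'.aemeasurable, ?_⟩
  ext s hs
  rw [pi_eq_comap_pathEval] at hs
  obtain ⟨B, hB, rfl⟩ := hs
  rw [Measure.map_apply m (measurable_pathEval hB), Measure.map_apply m' (measurable_pathEval hB)]
  have := congrArg (fun μ => μ B) hmap
  simp only [Measure.map_apply e hB, Measure.map_apply e' hB] at this
  exact this

end Law

end StableOU

theorem proposition1p4p3 {T α cp cm χ : ℝ} (hT : 0 < T) (hα0 : 0 < α) (hα2 : α < 2)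
    (hcp : 0 ≤ cp) (hcm : 0 ≤ cm) (hc : 0 < cp + cm) (hχ : 0 < χ)
    {Ω Ω' : Type*} [MeasurableSpace Ω] [MeasurableSpace Ω']
    (P : Measure Ω) (P' : Measure Ω') [IsProbabilityMeasure P] [IsProbabilityMeasure P']
    (Y : Set.Icc (0 : ℝ) T → Ω → StableOU.TemperedDist)
    (Y' : Set.Icc (0 : ℝ) T → Ω' → StableOU.TemperedDist)
    (hY : StableOU.IsStationarySolution hT cp cm α χ P Y)
    (hY' : StableOU.IsStationarySolution hT cp cm α χ P' Y') :
    IdentDistrib (fun ω t => Y t ω) (fun ω t => Y' t ω) P P' := by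
  exact StableOU.identDistrib_of_integral_exp_eq (fun t => (hY.whiteNoise t).1)
    (fun t => (hY'.whiteNoise t).1)
    (StableOU.integral_exp_sum_eq hα0 hα2 hcp hcm hχ hY hY')
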